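/- Let $0<\beta<1$ and $0<\gamma\le 1$ with $1+\beta+\gamma>2$, and put $$a=\frac{1+\beta-\gamma}{2},\qquad b=\frac{\beta+\gamma-1}{2},\qquad B=\frac{\Gamma(a)\Gamma(b)}{\Gamma(a+b)},\qquad S=\frac{\pi\sin(\pi(a+b))}{\sin(\pi a)\sin(\pi b)},\qquad K_1=-\frac{S}{B}.$$ Let $F(a,b,c;\cdot)$ be the Gaussian hypergeometric function, continued analytically from the unit disk to $\mathbb C\setminus[1,+\infty)$, and let $\varphi_1(z)=F(a,b,1;z)$, $\varphi_2(z)=F(a,b,a+b;1-z)$. The generalized hyperbolic density of orders $1,\beta,\gamma$ at $0,1,\infty$ is $$\lambda(z)=\lambda_{1,\beta,\gamma}(z)=\frac{1}{|z|\,|1-z|^{\beta}}\cdot\frac{1/B}{K_1|\varphi_1(z)|^2+2\operatorname{Re}\big(\varphi_1(z)\varphi_2(\bar z)\big)},$$ the values at the points of $\mathbb C\setminus\{0,1\}$ on the cuts $(-\infty,0]$ and $[1,+\infty)$ being given by continuous extension. Let $w$ be its remainder function at the cusp $0$, defined by $$\log\lambda(z)=-\log|z|-\log\log(1/|z|)+w(z).$$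 Write $\partial=\frac{\partial}{\partial z}$, $\bar\partial=\frac{\partial}{\partial\bar z}$, $\Psi=\Gamma'/\Gamma$ and $G(x)=2\Psi(1)-\Psi(x)-\Psi(1-x)$. In a punctured neighbourhood of $0$, $\lambda$ is positive and $w$ is $C^\infty$ and bounded. For all integers $m,n\ge 1$, (i) $\displaystyle\lim_{z\to0}z^n\log^2(1/|z|)\,\partial^n w(z)=\frac{(-1)^n(n-1)!}{4}\,\big(G(a)+G(b)\big)$, (ii) $\displaystyle\lim_{z\to0}z^n\bar z^m\log^3(1/|z|)\,\bar\partial^m\partial^n w(z)=\frac{(-1)^{m+n-1}(n-1)!\,(m-1)!}{4}\,\big(G(a)+G(b)\big)$. Moreover $G(a)+G(b)>0$. Consequently the general estimates $\partial^n w,\ \bar\partial^n w=O(|z|^{-n}\log^{-2}(1/|z|))$ and $\bar\partial^m\partial^n w=O(|z|^{-m-n}\log^{-3}(1/|z|))$ are sharp for this density: as $z\to0$, $|\partial^n w|$ and $|\bar\partial^n w|$ are bounded above and below by positive constant multiples of $|z|^{-n}\log^{-2}(1/|z|)$, and $|\bar\partial^m\partial^n w|$ is bounded above and below by positive constant multiples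 of $|z|^{-m-n}\log^{-3}(1/|z|)$. -/

import Mathlib

open Filter Topology Asymptotics
open scoped ContDiff

noncomputable section

/-- The Gaussian hypergeometric function `F(a, b, c; ·)`: the analytic function on the slit plane
`ℂ ∖ [1, ∞)` that is given on the unit disk by the hypergeometric series.  It is unique on the
slit plane by the identity theorem; its values on the cut `[1, ∞)` are unspecified. -/
def gaussF (a b c : ℂ) : ℂ → ℂ :=
  Classical.epsilon fun f : ℂ → ℂ =>
    AnalyticOnNhd ℂ f {z : ℂ | 1 - z ∈ Complex.slitPlane} ∧
      ∀ z : ℂ, ‖z‖ < 1 → f z = ₂F₁ a b c z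

/-- The parameter `a = (α + β - γ) / 2` for `α = 1`. -/
def cuspA (β γ : ℝ) : ℝ := (1 + β - γ) / 2

/-- The parameter `b = (α + β + γ - 2) / 2` for `α = 1`. -/
def cuspB (β γ : ℝ) : ℝ := (β + γ - 1) / 2

/-- The beta function `B(a, b) = Γ(a) Γ(b) / Γ(a + b)`. -/
def eulerBeta (a b : ℝ) : ℝ := Real.Gamma a * Real.Gamma b / Real.Gamma (a + b)

/-- The constant `K₁ = -S / B`, with `S = π sin (π (a + b)) / (sin (π a) sin (π b))`. -/
def cuspK₁ (a b : ℝ) : ℝ :=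
  -(Real.pi * Real.sin (Real.pi * (a + b)) / (Real.sin (Real.pi * a) * Real.sin (Real.pi * b)))
    / eulerBeta a b

/-- `M(z) = K₁ |φ₁(z)|² + 2 Re (φ₁(z) φ₂(z̄))` with `φ₁(z) = F(a, b, 1; z)` and
`φ₂(z) = F(a, b, a + b; 1 - z)`. -/
def cuspM (a b : ℝ) (z : ℂ) : ℝ :=
  cuspK₁ a b * ‖gaussF a b 1 z‖ ^ 2
    + 2 * (gaussF a b 1 z * gaussF a b (a + b) (1 - starRingEnd ℂ z)).re

/-- The generalized hyperbolic density of orders `1, β, γ` at `0, 1, ∞`.  Its explicit formula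
involves `φ₁` and `φ₂` off their cuts `[1, ∞)` and `(-∞, 0]`; at the points of `ℂ ∖ {0, 1}` on
these cuts the density is given by continuous extension. -/
def hypDensity (β γ : ℝ) : ℂ → ℝ :=
  extendFrom {z : ℂ | z ∈ Complex.slitPlane ∧ 1 - z ∈ Complex.slitPlane} fun z =>
    1 / ‖z‖ * (1 / ‖1 - z‖ ^ β)
      * ((1 / eulerBeta (cuspA β γ) (cuspB β γ)) / cuspM (cuspA β γ) (cuspB β γ) z)

/-- The remainder function `w` at the cusp `0`:
`log λ(z) = -log |z| - log log (1 / |z|) + w(z)`. -/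
def cuspRemainder (β γ : ℝ) (z : ℂ) : ℝ :=
  Real.log (hypDensity β γ z) + Real.log ‖z‖ + Real.log (Real.log (1 / ‖z‖))

/-- The Wirtinger derivative `∂f = (f_x - i f_y) / 2`. -/
def wirtinger (f : ℂ → ℂ) (z : ℂ) : ℂ :=
  (fderiv ℝ f z 1 - Complex.I * fderiv ℝ f z Complex.I) / 2

/-- The conjugate Wirtinger derivative `∂̄f = (f_x + i f_y) / 2`. -/
def wirtingerBar (f : ℂ → ℂ) (z : ℂ) : ℂ :=
  (fderiv ℝ f z 1 + Complex.I * fderiv ℝ f z Complex.I) / 2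

/-- The digamma function `Ψ = Γ' / Γ` of a real variable. -/
def realDigamma (x : ℝ) : ℝ := logDeriv Real.Gamma x

/-- `G(x) = 2 Ψ(1) - Ψ(x) - Ψ(1 - x)`. -/
def digammaG (x : ℝ) : ℝ := 2 * realDigamma 1 - realDigamma x - realDigamma (1 - x)

end

noncomputable section

/-! ### Wirtinger derivatives -/

/-! Put τ = 1 / log (1/|z|). The remainder is `w(z) = Φ(z, τ)` with Φ smooth at the origin of ℂ × ℝ,
and both limits can be read off from ∂Φ/∂τ at (0, 0).

The source of Φ is the connection formula `B φ₂(z) = φ₁(z) (-log z + Q(z))` with Q holomorphic at 0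
and `Q(0) = 2Ψ(1) - Ψ(a) - Ψ(b)` (`exists_connection_formula`). It gives `B M = |φ₁|² (2 log (1/|z|)
+ H)`, where H(z) = 2 Re Q(z̄) - S, hence w = -β log|1 - z| - 2 log|φ₁| - log(2 + H τ). So ∂Φ/∂τ(0,
0) = -H(0)/2, and the reflection formula for Γ turns H(0) into G(a) + G(b). This is positive since Ψ
is increasing.

Since z ∂τ = z̄ ∂̄τ = τ²/2, the operator z∂ acts on functions of (z, τ) as z ∂_z + (τ²/2) ∂_τ, and
on the slice z = 0 only the second term survives. The first derivative therefore has order τ². As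
z^(n+1) ∂^(n+1) = (z∂ - n) zⁿ ∂ⁿ, each further ∂ keeps that order and multiplies the leading
coefficient by -n. The first ∂̄ after some ∂ has nothing to subtract and raises the order to τ³,
later ones contribute -m. Away from the slice the error is O(|z|), which beats every power of the
logarithm (`CuspOrder.tendsto`).

The form `K log z` + holomorphic in the connection formula comes from constancy of the Wronskian
(`exists_log_expansion`). The two constants come from Mellin transforms: that of Euler's integral is
Γ(ε)² Γ(a-ε) Γ(b-ε) / (Γ(a) Γ(b)), and comparison with the elementary case a = b = 1 at ε = 0
identifies them (`eulerReal_expansion_constants`). -/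

theorem wirtinger_congr {f g : ℂ → ℂ} {z : ℂ} (h : f =ᶠ[𝓝 z] g) :
    wirtinger f z = wirtinger g z := by
  simp only [wirtinger, h.fderiv_eq]

theorem wirtingerBar_congr {f g : ℂ → ℂ} {z : ℂ} (h : f =ᶠ[𝓝 z] g) :
    wirtingerBar f z = wirtingerBar g z := by
  simp only [wirtingerBar, h.fderiv_eq]

theorem wirtinger_mul {f g : ℂ → ℂ} {z : ℂ} (hf : DifferentiableAt ℝ f z)
    (hg : DifferentiableAt ℝ g z) :
    wirtinger (fun ζ => f ζ * g ζ) z = f z * wirtinger g z + g z * wirtinger f z := by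
  simp only [wirtinger, fderiv_fun_mul hf hg, add_apply, smul_apply, smul_eq_mul]
  ring

theorem wirtingerBar_mul {f g : ℂ → ℂ} {z : ℂ} (hf : DifferentiableAt ℝ f z)
    (hg : DifferentiableAt ℝ g z) :
    wirtingerBar (fun ζ => f ζ * g ζ) z = f z * wirtingerBar g z + g z * wirtingerBar f z := by
  simp only [wirtingerBar, fderiv_fun_mul hf hg, add_apply, smul_apply, smul_eq_mul]
  ring

theorem HasDerivAt.hasFDerivAt_real {f : ℂ → ℂ} {f' z : ℂ} (h : HasDerivAt f f' z) :
    HasFDerivAt (𝕜 := ℝ) f (f' • (1 : ℂ →L[ℝ] ℂ)) z :=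
  h.complexToReal_fderiv

theorem HasDerivAt.hasFDerivAt_comp_conj {f : ℂ → ℂ} {f' z : ℂ}
    (h : HasDerivAt f f' (starRingEnd ℂ z)) :
    HasFDerivAt (𝕜 := ℝ) (fun ζ => f (starRingEnd ℂ ζ))
      ((f' • (1 : ℂ →L[ℝ] ℂ)).comp (Complex.conjCLE : ℂ →L[ℝ] ℂ)) z :=
  HasFDerivAt.comp z (f := fun ζ => starRingEnd ℂ ζ) h.hasFDerivAt_real
    (Complex.conjCLE : ℂ →L[ℝ] ℂ).hasFDerivAt

theorem wirtinger_of_hasDerivAt {f : ℂ → ℂ} {f' z : ℂ} (h : HasDerivAt f f' z) :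
    wirtinger f z = f' := by
  simp only [wirtinger, h.hasFDerivAt_real.fderiv, smul_apply, smul_eq_mul,
    one_apply_eq_self]
  linear_combination (-f' / 2) * Complex.I_mul_I

theorem wirtingerBar_of_hasDerivAt {f : ℂ → ℂ} {f' z : ℂ} (h : HasDerivAt f f' z) :
    wirtingerBar f z = 0 := by
  simp only [wirtingerBar, h.hasFDerivAt_real.fderiv, smul_apply, smul_eq_mul,
    one_apply_eq_self]
  linear_combination (f' / 2) * Complex.I_mul_I

theorem wirtinger_comp_conj_of_hasDerivAt {f : ℂ → ℂ} {f' z : ℂ}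
    (h : HasDerivAt f f' (starRingEnd ℂ z)) :
    wirtinger (fun ζ => f (starRingEnd ℂ ζ)) z = 0 := by
  simp only [wirtinger, h.hasFDerivAt_comp_conj.fderiv, smul_apply, smul_eq_mul,
    one_apply_eq_self, ContinuousLinearMap.comp_apply, ContinuousLinearEquiv.coe_coe,
    Complex.conjCLE_apply, map_one, Complex.conj_I]
  linear_combination (f' / 2) * Complex.I_mul_I

theorem wirtingerBar_comp_conj_of_hasDerivAt {f : ℂ → ℂ} {f' z : ℂ}
    (h : HasDerivAt f f' (starRingEnd ℂ z)) :
    wirtingerBar (fun ζ => f (starRingEnd ℂ ζ)) z = f' := by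
  simp only [wirtingerBar, h.hasFDerivAt_comp_conj.fderiv, smul_apply, smul_eq_mul,
    one_apply_eq_self, ContinuousLinearMap.comp_apply, ContinuousLinearEquiv.coe_coe,
    Complex.conjCLE_apply, map_one, Complex.conj_I]
  linear_combination (-f' / 2) * Complex.I_mul_I

/-! ### Smooth functions of `z` and `1 / log (1 / |z|)` -/

/-- The point `(z, 1 / log (1 / |z|))`. -/
def cuspPoint (z : ℂ) : ℂ × ℝ := (z, (Real.log (1 / ‖z‖))⁻¹)

/-- The operator that `z ∂` induces on functions of `(z, 1 / log (1 / |z|))`. -/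
def cuspD (Ψ : ℂ × ℝ → ℂ) (p : ℂ × ℝ) : ℂ :=
  p.1 * ((fderiv ℝ Ψ p (1, 0) - Complex.I * fderiv ℝ Ψ p (Complex.I, 0)) / 2)
    + (p.2 : ℂ) ^ 2 / 2 * fderiv ℝ Ψ p (0, 1)

/-- The operator that `z̄ ∂̄` induces on functions of `(z, 1 / log (1 / |z|))`. -/
def cuspDBar (Ψ : ℂ × ℝ → ℂ) (p : ℂ × ℝ) : ℂ :=
  starRingEnd ℂ p.1 * ((fderiv ℝ Ψ p (1, 0) + Complex.I * fderiv ℝ Ψ p (Complex.I, 0)) / 2)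
    + (p.2 : ℂ) ^ 2 / 2 * fderiv ℝ Ψ p (0, 1)

/-- The function `Ψ` is smooth near the origin. -/
def SmoothNear (Ψ : ℂ × ℝ → ℂ) : Prop := ∀ᶠ p in 𝓝 (0 : ℂ × ℝ), ContDiffAt ℝ ∞ Ψ p

theorem ContDiffAt.fderiv_apply_const {E : Type*} [NormedAddCommGroup E] [NormedSpace ℝ E]
    {Ψ : E → ℂ} {p : E} (h : ContDiffAt ℝ ∞ Ψ p) (v : E) :
    ContDiffAt ℝ ∞ (fun q => fderiv ℝ Ψ q v) p :=
  (h.fderiv_right (m := ∞) (by simp)).clm_apply contDiffAt_const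

theorem contDiff_ofReal {n : WithTop ℕ∞} : ContDiff ℝ n (fun x : ℝ => (x : ℂ)) :=
  Complex.ofRealCLM.contDiff

theorem SmoothNear.cuspD_sub {Ψ : ℂ × ℝ → ℂ} (h : SmoothNear Ψ) (j : ℂ) :
    SmoothNear fun p => cuspD Ψ p - j * Ψ p := by
  filter_upwards [h] with p hp
  have h1 := hp.fderiv_apply_const ((1, 0) : ℂ × ℝ)
  have h2 := hp.fderiv_apply_const ((Complex.I, 0) : ℂ × ℝ)
  have h3 := hp.fderiv_apply_const ((0, 1) : ℂ × ℝ)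
  have h4 : ContDiffAt ℝ ∞ (fun q : ℂ × ℝ => (q.2 : ℂ)) p :=
    contDiff_ofReal.contDiffAt.comp p contDiffAt_snd
  unfold cuspD
  exact ((contDiffAt_fst.mul ((h1.sub (contDiffAt_const.mul h2)).div_const 2)).add
    (((h4.pow 2).div_const 2).mul h3)).sub (contDiffAt_const.mul hp)

theorem SmoothNear.cuspDBar_sub {Ψ : ℂ × ℝ → ℂ} (h : SmoothNear Ψ) (j : ℂ) :
    SmoothNear fun p => cuspDBar Ψ p - j * Ψ p := by
  filter_upwards [h] with p hp
  have h1 := hp.fderiv_apply_const ((1, 0) : ℂ × ℝ)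
  have h2 := hp.fderiv_apply_const ((Complex.I, 0) : ℂ × ℝ)
  have h3 := hp.fderiv_apply_const ((0, 1) : ℂ × ℝ)
  have h4 : ContDiffAt ℝ ∞ (fun q : ℂ × ℝ => (q.2 : ℂ)) p :=
    contDiff_ofReal.contDiffAt.comp p contDiffAt_snd
  have h5 : ContDiffAt ℝ ∞ (fun q : ℂ × ℝ => starRingEnd ℂ q.1) p :=
    (Complex.conjCLE : ℂ →L[ℝ] ℂ).contDiff.contDiffAt.comp p contDiffAt_fst
  unfold cuspDBar
  exact ((h5.mul ((h1.add (contDiffAt_const.mul h2)).div_const 2)).add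
    (((h4.pow 2).div_const 2).mul h3)).sub (contDiffAt_const.mul hp)

/-! ### The variable 1 / log (1/|z|) and the chain rule. -/

theorem tendsto_log_one_div_norm :
    Tendsto (fun z : ℂ => Real.log (1 / ‖z‖)) (𝓝[≠] 0) atTop := by
  simp only [one_div, Real.log_inv]
  exact tendsto_neg_atBot_atTop.comp (Real.tendsto_log_nhdsGT_zero.comp tendsto_norm_nhdsNE_zero)

theorem tendsto_inv_log_one_div_norm :
    Tendsto (fun z : ℂ => (Real.log (1 / ‖z‖))⁻¹) (𝓝[≠] 0) (𝓝 0) :=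
  tendsto_inv_atTop_zero.comp tendsto_log_one_div_norm

theorem tendsto_cuspPoint : Tendsto cuspPoint (𝓝[≠] 0) (𝓝 0) :=
  (tendsto_id.mono_left nhdsWithin_le_nhds : Tendsto (fun z : ℂ => z) (𝓝[≠] 0) (𝓝 0)).prodMk_nhds
    tendsto_inv_log_one_div_norm

theorem hasFDerivAt_log_one_div_norm {z : ℂ} (hz : z ≠ 0) :
    HasFDerivAt (fun ζ : ℂ => Real.log (1 / ‖ζ‖)) (-(‖z‖ ^ 2)⁻¹ • innerSL ℝ z) z := by
  have h1 : HasFDerivAt (fun ζ : ℂ => ‖ζ‖ ^ 2) (2 • innerSL ℝ z) z :=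
    (hasStrictFDerivAt_norm_sq z).hasFDerivAt
  have h2 := (h1.log (by positivity)).const_mul (-1 / 2)
  have h3 : (fun ζ : ℂ => Real.log (1 / ‖ζ‖)) = fun ζ => -1 / 2 * Real.log (‖ζ‖ ^ 2) := by
    funext ζ
    simp only [one_div, Real.log_inv, Real.log_pow]
    push_cast
    ring
  rw [h3]
  refine h2.congr_fderiv ?_
  ext
  simp
  all_goals ring

theorem hasFDerivAt_inv_log_one_div_norm {z : ℂ} (hz : z ≠ 0) (hz1 : Real.log (1 / ‖z‖) ≠ 0) :
    HasFDerivAt (fun ζ : ℂ => (Real.log (1 / ‖ζ‖))⁻¹)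
      ((((Real.log (1 / ‖z‖))⁻¹ ^ 2) * (‖z‖ ^ 2)⁻¹) • innerSL ℝ z) z := by
  have h := (hasDerivAt_inv hz1).comp_hasFDerivAt z (hasFDerivAt_log_one_div_norm hz)
  refine h.congr_fderiv ?_
  rw [smul_smul, inv_pow]
  congr 1
  ring

theorem hasFDerivAt_comp_cuspPoint {Ψ : ℂ × ℝ → ℂ} {z : ℂ} (hz : z ≠ 0)
    (hz1 : Real.log (1 / ‖z‖) ≠ 0) (h : DifferentiableAt ℝ Ψ (cuspPoint z)) :
    HasFDerivAt (fun ζ => Ψ (cuspPoint ζ))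
      ((fderiv ℝ Ψ (cuspPoint z)).comp ((ContinuousLinearMap.id ℝ ℂ).prod
        ((((Real.log (1 / ‖z‖))⁻¹ ^ 2) * (‖z‖ ^ 2)⁻¹) • innerSL ℝ z))) z :=
  HasFDerivAt.comp z h.hasFDerivAt
    ((hasFDerivAt_id z).prodMk (hasFDerivAt_inv_log_one_div_norm hz hz1))

theorem ContinuousLinearMap.apply_prod_eq (T : ℂ × ℝ →L[ℝ] ℂ) (v : ℂ) (s : ℝ) :
    T (v, s) = T (v, 0) + s * T (0, 1) := by
  have : (v, s) = (v, (0 : ℝ)) + s • ((0 : ℂ), (1 : ℝ)) := by simp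
  rw [this, map_add, map_smul, Complex.real_smul]

/-- Chain rule: the real gradient of τ = 1 / log (1/|z|) is τ² z / |z|², so ∂τ = τ² z̄ / (2|z|²) =
τ² / (2z). -/
theorem mul_wirtinger_comp_cuspPoint {Ψ : ℂ × ℝ → ℂ} {z : ℂ} (hz : z ≠ 0)
    (hz1 : Real.log (1 / ‖z‖) ≠ 0) (h : DifferentiableAt ℝ Ψ (cuspPoint z)) :
    z * wirtinger (fun ζ => Ψ (cuspPoint ζ)) z = cuspD Ψ (cuspPoint z) := by
  have e1 : (‖z‖ : ℂ) ^ 2 = z * starRingEnd ℂ z := (Complex.mul_conj' z).symm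
  have e2 : starRingEnd ℂ z = z.re - z.im * Complex.I := by
    rw [Complex.ext_iff]; simp
  have e3 : (‖z‖ : ℂ) ≠ 0 := by simpa using hz
  have e4 : z * (starRingEnd ℂ z * ((‖z‖ : ℂ) ^ 2)⁻¹) = 1 := by
    rw [← mul_assoc, ← e1]; field_simp
  simp only [wirtinger, (hasFDerivAt_comp_cuspPoint hz hz1 h).fderiv, cuspD,
    ContinuousLinearMap.comp_apply, ContinuousLinearMap.prod_apply, ContinuousLinearMap.id_apply,
    smul_apply, innerSL_apply_apply, Complex.inner]
  rw [ContinuousLinearMap.apply_prod_eq _ 1, ContinuousLinearMap.apply_prod_eq _ Complex.I]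
  rw [e2] at e4
  simp only [cuspPoint, smul_eq_mul, Complex.one_re, Complex.one_im, Complex.conj_re, Complex.mul_re, Complex.I_re,
    Complex.I_im, Complex.conj_im]
  push_cast
  linear_combination ((Real.log (1 / ‖z‖) : ℂ)⁻¹ ^ 2 / 2 *
    fderiv ℝ Ψ (z, (Real.log (1 / ‖z‖))⁻¹) (0, 1)) * e4

theorem mul_wirtingerBar_comp_cuspPoint {Ψ : ℂ × ℝ → ℂ} {z : ℂ} (hz : z ≠ 0)
    (hz1 : Real.log (1 / ‖z‖) ≠ 0) (h : DifferentiableAt ℝ Ψ (cuspPoint z)) :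
    starRingEnd ℂ z * wirtingerBar (fun ζ => Ψ (cuspPoint ζ)) z = cuspDBar Ψ (cuspPoint z) := by
  have e1 : (‖z‖ : ℂ) ^ 2 = z * starRingEnd ℂ z := (Complex.mul_conj' z).symm
  have e2 : z = z.re + z.im * Complex.I := (Complex.re_add_im z).symm
  have e3 : (‖z‖ : ℂ) ≠ 0 := by simpa using hz
  have e4 : starRingEnd ℂ z * ((z.re + z.im * Complex.I) * ((‖z‖ : ℂ) ^ 2)⁻¹) = 1 := by
    rw [← e2, ← mul_assoc, mul_comm _ z, ← e1]; field_simp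
  simp only [wirtingerBar, (hasFDerivAt_comp_cuspPoint hz hz1 h).fderiv, cuspDBar,
    ContinuousLinearMap.comp_apply, ContinuousLinearMap.prod_apply, ContinuousLinearMap.id_apply,
    smul_apply, innerSL_apply_apply, Complex.inner]
  rw [ContinuousLinearMap.apply_prod_eq _ 1, ContinuousLinearMap.apply_prod_eq _ Complex.I]
  simp only [cuspPoint, smul_eq_mul, Complex.one_re, Complex.one_im, Complex.conj_re, Complex.mul_re, Complex.I_re,
    Complex.I_im, Complex.conj_im]
  push_cast
  linear_combination ((Real.log (1 / ‖z‖) : ℂ)⁻¹ ^ 2 / 2 *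
    fderiv ℝ Ψ (z, (Real.log (1 / ‖z‖))⁻¹) (0, 1)) * e4

/-- The function `z⁻ⁿ z̄⁻ᵐ Ψ(z, 1 / log (1 / |z|))`. -/
def cuspTerm (n m : ℕ) (Ψ : ℂ × ℝ → ℂ) (z : ℂ) : ℂ :=
  (z ^ n)⁻¹ * ((starRingEnd ℂ z ^ m)⁻¹ * Ψ (cuspPoint z))

theorem hasDerivAt_inv_pow {z : ℂ} (hz : z ≠ 0) (n : ℕ) :
    HasDerivAt (fun ζ : ℂ => (ζ ^ n)⁻¹) (-(n : ℂ) * (z ^ (n + 1))⁻¹) z := by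
  have h := (hasDerivAt_pow n z).inv (pow_ne_zero n hz)
  refine h.congr_deriv ?_
  -- The power rule carries the truncated exponent `n - 1`, so `n = 0` is separate.
  cases n with
  | zero => simp
  | succ n =>
    simp only [Nat.add_sub_cancel]
    field_simp
    ring

theorem eventually_log_one_div_norm_pos : ∀ᶠ z in 𝓝[≠] (0 : ℂ), 0 < Real.log (1 / ‖z‖) :=
  tendsto_log_one_div_norm.eventually_gt_atTop 0

/-- This is z^(n+1) ∂(z⁻ⁿ Ψ) = (z∂ - n) Ψ; the factor z̄⁻ᵐ is antiholomorphic and passes through ∂.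
-/
theorem wirtinger_eventuallyEq_cuspTerm {F : ℂ → ℂ} {Ψ : ℂ × ℝ → ℂ} {n m : ℕ}
    (hF : F =ᶠ[𝓝[≠] 0] cuspTerm n m Ψ) (hΨ : SmoothNear Ψ) :
    wirtinger F =ᶠ[𝓝[≠] 0] cuspTerm (n + 1) m fun p => cuspD Ψ p - n * Ψ p := by
  filter_upwards [eventually_eventually_nhdsWithin.mpr hF, tendsto_cuspPoint.eventually hΨ,
    eventually_log_one_div_norm_pos, self_mem_nhdsWithin] with z h1 h2 h3 (hz : z ≠ 0)
  -- The punctured plane is open, so the equality holds in a full neighbourhood of `z` and may be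
  -- differentiated.
  rw [isOpen_compl_singleton.nhdsWithin_eq hz] at h1
  have d : DifferentiableAt ℝ Ψ (cuspPoint z) := h2.differentiableAt (by simp)
  have dc := (hasFDerivAt_comp_cuspPoint hz h3.ne' d).differentiableAt
  have d1 := hasDerivAt_inv_pow hz n
  have d2 := hasDerivAt_inv_pow ((map_ne_zero (starRingEnd ℂ)).mpr hz) m
  have d2' := d2.hasFDerivAt_comp_conj.differentiableAt
  rw [wirtinger_congr (g := cuspTerm n m Ψ) h1]
  unfold cuspTerm
  beta_reduce
  rw [wirtinger_mul d1.hasFDerivAt_real.differentiableAt (d2'.fun_mul dc), wirtinger_mul d2' dc,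
    wirtinger_of_hasDerivAt d1, wirtinger_comp_conj_of_hasDerivAt d2,
    ← mul_wirtinger_comp_cuspPoint hz h3.ne' d]
  field_simp
  ring

theorem wirtingerBar_eventuallyEq_cuspTerm {F : ℂ → ℂ} {Ψ : ℂ × ℝ → ℂ} {n m : ℕ}
    (hF : F =ᶠ[𝓝[≠] 0] cuspTerm n m Ψ) (hΨ : SmoothNear Ψ) :
    wirtingerBar F =ᶠ[𝓝[≠] 0] cuspTerm n (m + 1) fun p => cuspDBar Ψ p - m * Ψ p := by
  filter_upwards [eventually_eventually_nhdsWithin.mpr hF, tendsto_cuspPoint.eventually hΨ,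
    eventually_log_one_div_norm_pos, self_mem_nhdsWithin] with z h1 h2 h3 (hz : z ≠ 0)
  rw [isOpen_compl_singleton.nhdsWithin_eq hz] at h1
  have hz' : starRingEnd ℂ z ≠ 0 := (map_ne_zero (starRingEnd ℂ)).mpr hz
  have d : DifferentiableAt ℝ Ψ (cuspPoint z) := h2.differentiableAt (by simp)
  have dc := (hasFDerivAt_comp_cuspPoint hz h3.ne' d).differentiableAt
  have d1 := hasDerivAt_inv_pow hz n
  have d2 := hasDerivAt_inv_pow hz' m
  have d2' := d2.hasFDerivAt_comp_conj.differentiableAt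
  rw [wirtingerBar_congr (g := cuspTerm n m Ψ) h1]
  unfold cuspTerm
  beta_reduce
  rw [wirtingerBar_mul d1.hasFDerivAt_real.differentiableAt (d2'.fun_mul dc), wirtingerBar_mul d2' dc,
    wirtingerBar_of_hasDerivAt d1, wirtingerBar_comp_conj_of_hasDerivAt d2,
    ← mul_wirtingerBar_comp_cuspPoint hz h3.ne' d]
  field_simp
  ring

/-- The function `Ψ` is smooth near the origin, and `Ψ(0, τ) = τᵏ r(τ)` with `r` smooth and
`r(0) = c`. -/
structure CuspOrder (Ψ : ℂ × ℝ → ℂ) (k : ℕ) (c : ℂ) : Prop where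
  smooth : SmoothNear Ψ
  expansion : ∃ r : ℝ → ℂ, (∀ᶠ τ in 𝓝 0, ContDiffAt ℝ ∞ r τ) ∧
    (∀ᶠ τ : ℝ in 𝓝 0, Ψ (0, τ) = (τ : ℂ) ^ k * r τ) ∧ r 0 = c

theorem tendsto_zero_prodMk : Tendsto (fun τ : ℝ => ((0 : ℂ), τ)) (𝓝 0) (𝓝 0) :=
  Continuous.tendsto' (by fun_prop) _ _ rfl

theorem hasDerivAt_snd_slice {Ψ : ℂ × ℝ → ℂ} {z : ℂ} {τ : ℝ}
    (h : DifferentiableAt ℝ Ψ (z, τ)) :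
    HasDerivAt (fun t : ℝ => Ψ (z, t)) (fderiv ℝ Ψ (z, τ) (0, 1)) τ :=
  h.hasFDerivAt.comp_hasDerivAt τ ((hasDerivAt_const τ z).prodMk (hasDerivAt_id τ))

/-- Product rule for τᵏ r(τ): the factor τ² gains one power over the one lost by differentiation. -/
theorem CuspOrder.fderiv_slice {Ψ : ℂ × ℝ → ℂ} {k : ℕ} {c : ℂ} (h : CuspOrder Ψ k c) :
    ∃ r r' : ℝ → ℂ, (∀ᶠ τ in 𝓝 0, ContDiffAt ℝ ∞ r τ) ∧ (∀ᶠ τ in 𝓝 0, ContDiffAt ℝ ∞ r' τ) ∧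
      (∀ᶠ τ : ℝ in 𝓝 0, Ψ (0, τ) = (τ : ℂ) ^ k * r τ) ∧ r 0 = c ∧
      ∀ᶠ τ : ℝ in 𝓝 0, (τ : ℂ) ^ 2 / 2 * fderiv ℝ Ψ (0, τ) (0, 1) =
        (τ : ℂ) ^ (k + 1) * (k / 2 * r τ + τ / 2 * r' τ) := by
  obtain ⟨r, hr, hΨ, h0⟩ := h.expansion
  refine ⟨r, fun τ => fderiv ℝ r τ 1, hr, ?_, hΨ, h0, ?_⟩
  · filter_upwards [hr] with τ hτ using hτ.fderiv_apply_const 1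
  · filter_upwards [hr, hΨ.eventually_nhds, tendsto_zero_prodMk.eventually h.smooth]
      with τ h1 h2 h3
    have d1 := hasDerivAt_snd_slice (h3.differentiableAt (by simp))
    have d2 : HasDerivAt r (fderiv ℝ r τ 1) τ :=
      (h1.differentiableAt (by simp)).hasFDerivAt.hasDerivAt
    have d3 : HasDerivAt (fun t : ℝ => (t : ℂ) ^ k) (k * (τ : ℂ) ^ (k - 1)) τ :=
      (hasDerivAt_pow k (τ : ℂ)).comp_ofReal
    have d4 := (d3.mul d2).congr_of_eventuallyEq (f₁ := fun t => Ψ (0, t)) h2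
    rw [d1.unique d4]
    cases k with
    | zero => simp; ring
    | succ k => simp only [Nat.add_sub_cancel]; push_cast; ring

/-- The case with nothing subtracted, met by the first ∂̄ applied after some ∂: the order goes up by
one. -/
theorem CuspOrder.derivation {Ψ Ψ' : ℂ × ℝ → ℂ} {k : ℕ} {c : ℂ} (h : CuspOrder Ψ k c)
    (hs : SmoothNear Ψ')
    (h' : ∀ τ : ℝ, Ψ' (0, τ) = (τ : ℂ) ^ 2 / 2 * fderiv ℝ Ψ (0, τ) (0, 1)) :
    CuspOrder Ψ' (k + 1) (k / 2 * c) := by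
  obtain ⟨r, r', hr, hr', h1, h2, h3⟩ := h.fderiv_slice
  refine ⟨hs, fun τ => k / 2 * r τ + τ / 2 * r' τ, ?_, ?_, by simp [h2]⟩
  · filter_upwards [hr, hr'] with τ h4 h5
    exact (contDiffAt_const.mul h4).add ((contDiff_ofReal.contDiffAt.div_const 2).mul h5)
  · filter_upwards [h3] with τ h4
    rw [h', h4]

/-- The derivative term has order k + 1, so the leading term is that of -jΨ. -/
theorem CuspOrder.derivation_sub {Ψ Ψ' : ℂ × ℝ → ℂ} {k : ℕ} {c : ℂ} (h : CuspOrder Ψ k c)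
    (hs : SmoothNear Ψ') (j : ℂ)
    (h' : ∀ τ : ℝ, Ψ' (0, τ) = (τ : ℂ) ^ 2 / 2 * fderiv ℝ Ψ (0, τ) (0, 1) - j * Ψ (0, τ)) :
    CuspOrder Ψ' k (-j * c) := by
  obtain ⟨r, r', hr, hr', h1, h2, h3⟩ := h.fderiv_slice
  refine ⟨hs, fun τ => τ * (k / 2 * r τ + τ / 2 * r' τ) - j * r τ, ?_, ?_, by simp [h2]⟩
  · filter_upwards [hr, hr'] with τ h4 h5
    exact (contDiff_ofReal.contDiffAt.mul ((contDiffAt_const.mul h4).add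
      ((contDiff_ofReal.contDiffAt.div_const 2).mul h5))).sub (contDiffAt_const.mul h4)
  · filter_upwards [h1, h3] with τ h4 h5
    rw [h', h4, h5]
    ring

theorem cuspD_zero_fst (Ψ : ℂ × ℝ → ℂ) (τ : ℝ) :
    cuspD Ψ (0, τ) = (τ : ℂ) ^ 2 / 2 * fderiv ℝ Ψ (0, τ) (0, 1) := by
  simp [cuspD]

theorem cuspDBar_zero_fst (Ψ : ℂ × ℝ → ℂ) (τ : ℝ) :
    cuspDBar Ψ (0, τ) = (τ : ℂ) ^ 2 / 2 * fderiv ℝ Ψ (0, τ) (0, 1) := by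
  simp [cuspDBar]

/-- Any `τ² / 2 · ∂Ψ/∂τ` has order two at the cusp. -/
theorem CuspOrder.of_smoothNear {Ψ Ψ' : ℂ × ℝ → ℂ} (h : SmoothNear Ψ) (hs : SmoothNear Ψ')
    (h' : ∀ τ : ℝ, Ψ' (0, τ) = (τ : ℂ) ^ 2 / 2 * fderiv ℝ Ψ (0, τ) (0, 1)) :
    CuspOrder Ψ' 2 (fderiv ℝ Ψ 0 (0, 1) / 2) := by
  refine ⟨hs, fun τ => fderiv ℝ Ψ (0, τ) (0, 1) / 2, ?_, ?_, rfl⟩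
  · filter_upwards [tendsto_zero_prodMk.eventually h] with τ hτ
    exact (ContDiffAt.comp τ (hτ.fderiv_apply_const (0, 1))
      (contDiffAt_const.prodMk contDiffAt_id)).div_const 2
  · exact Eventually.of_forall fun τ => by rw [h']; ring

/-- With L = log (1/|z|) → ∞ this is Lᵏ e^(-L). -/
theorem tendsto_norm_mul_log_pow (k : ℕ) :
    Tendsto (fun z : ℂ => ‖z‖ * Real.log (1 / ‖z‖) ^ k) (𝓝[≠] 0) (𝓝 0) := by
  have h := (Real.tendsto_pow_mul_exp_neg_atTop_nhds_zero k).comp tendsto_log_one_div_norm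
  refine h.congr' ?_
  filter_upwards [self_mem_nhdsWithin] with z (hz : z ≠ 0)
  simp only [Function.comp_apply, one_div, Real.log_inv, neg_neg,
    Real.exp_log (norm_pos_iff.mpr hz)]
  ring

/-- Ψ is C¹, hence Lipschitz near the origin, so replacing (z, τ) by (0, τ) costs O(|z|), which
tends to 0 even after multiplication by logᵏ. On the slice, logᵏ cancels τᵏ and leaves r(τ) → r(0).
-/
theorem CuspOrder.tendsto {Ψ : ℂ × ℝ → ℂ} {k : ℕ} {c : ℂ} (h : CuspOrder Ψ k c) :
    Tendsto (fun z => ((Real.log (1 / ‖z‖) ^ k : ℝ) : ℂ) * Ψ (cuspPoint z)) (𝓝[≠] 0) (𝓝 c) := by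
  obtain ⟨r, hr, hΨ, rfl⟩ := h.expansion
  obtain ⟨K, t, ht, hK⟩ := (h.smooth.self_of_nhds.of_le (m := 1)
    (by simp)).exists_lipschitzOnWith
  have h1 : Tendsto (fun z => r (Real.log (1 / ‖z‖))⁻¹) (𝓝[≠] (0 : ℂ)) (𝓝 (r 0)) :=
    (hr.self_of_nhds.continuousAt.tendsto).comp tendsto_inv_log_one_div_norm
  have h2 : Tendsto (fun z => ((Real.log (1 / ‖z‖) ^ k : ℝ) : ℂ) *
      (Ψ (cuspPoint z) - Ψ (0, (Real.log (1 / ‖z‖))⁻¹))) (𝓝[≠] (0 : ℂ)) (𝓝 0) := by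
    have h3 := (tendsto_norm_mul_log_pow k).const_mul (K : ℝ)
    rw [mul_zero] at h3
    refine squeeze_zero_norm' ?_ h3
    filter_upwards [tendsto_cuspPoint.eventually ht,
      (tendsto_zero_prodMk.comp tendsto_inv_log_one_div_norm).eventually ht,
      eventually_log_one_div_norm_pos] with z h4 h5 h6
    have h7 := hK.dist_le_mul _ h4 _ h5
    rw [dist_eq_norm, dist_eq_norm] at h7
    simp only [cuspPoint, Function.comp_apply, Prod.mk_sub_mk, sub_zero, sub_self,
      Prod.norm_mk, norm_zero, norm_nonneg, sup_of_le_left] at h7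
    rw [norm_mul, Complex.norm_real, Real.norm_of_nonneg (by positivity)]
    calc _ ≤ Real.log (1 / ‖z‖) ^ k * (K * ‖z‖) := by unfold cuspPoint; gcongr
      _ = _ := by ring
  have h8 := h2.add h1
  rw [zero_add] at h8
  refine h8.congr' ?_
  filter_upwards [(tendsto_inv_log_one_div_norm).eventually hΨ,
    eventually_log_one_div_norm_pos] with z h9 h10
  have h11 : (Real.log (1 / ‖z‖) : ℂ) ≠ 0 := by exact_mod_cast h10.ne'
  rw [h9]
  have h12 : (Real.log (1 / ‖z‖) : ℂ) ^ k * (Real.log (1 / ‖z‖) : ℂ)⁻¹ ^ k = 1 := by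
    rw [← mul_pow, mul_inv_cancel₀ h11, one_pow]
  push_cast
  linear_combination -r (Real.log (1 / ‖z‖))⁻¹ * h12

theorem CuspOrder.tendsto_cuspTerm {F : ℂ → ℂ} {Ψ : ℂ × ℝ → ℂ} {k n m : ℕ} {c : ℂ}
    (h : CuspOrder Ψ k c) (hF : F =ᶠ[𝓝[≠] 0] cuspTerm n m Ψ) :
    Tendsto (fun z => z ^ n * starRingEnd ℂ z ^ m * ((Real.log (1 / ‖z‖) ^ k : ℝ) : ℂ) * F z)
      (𝓝[≠] 0) (𝓝 c) := by
  refine h.tendsto.congr' ?_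
  filter_upwards [hF, self_mem_nhdsWithin] with z h1 (hz : z ≠ 0)
  have hz' : starRingEnd ℂ z ≠ 0 := (map_ne_zero (starRingEnd ℂ)).mpr hz
  rw [h1, cuspTerm]
  field_simp

/-- The first ∂ gives (τ²/2) ∂Φ/∂τ on the slice; every later one multiplies the leading coefficient
by minus the current exponent of 1/z, whence the signed factorial. -/
theorem exists_iterate_wirtinger {F : ℂ → ℂ} {Φ : ℂ × ℝ → ℂ}
    (hF : F =ᶠ[𝓝[≠] 0] fun z => Φ (cuspPoint z)) (hΦ : SmoothNear Φ) (n : ℕ) :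
    ∃ Ψ, wirtinger^[n + 1] F =ᶠ[𝓝[≠] 0] cuspTerm (n + 1) 0 Ψ ∧
      CuspOrder Ψ 2 ((-1) ^ n * n.factorial * (fderiv ℝ Φ 0 (0, 1) / 2)) := by
  induction n with
  | zero =>
    refine ⟨_, wirtinger_eventuallyEq_cuspTerm (n := 0) (m := 0) (Ψ := Φ)
      (hF.trans (Eventually.of_forall fun z => by simp [cuspTerm])) hΦ, ?_⟩
    have := CuspOrder.of_smoothNear hΦ (hΦ.cuspD_sub (0 : ℕ)) fun τ => by
      simp [cuspD_zero_fst]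
    simpa using this
  | succ n ih =>
    obtain ⟨Ψ, h1, h2⟩ := ih
    rw [Function.iterate_succ_apply']
    refine ⟨_, wirtinger_eventuallyEq_cuspTerm h1 h2.smooth, ?_⟩
    have := h2.derivation_sub (h2.smooth.cuspD_sub ((n + 1 : ℕ) : ℂ)) ((n + 1 : ℕ) : ℂ) fun τ => by
      simp only [cuspD_zero_fst]
    convert this using 1
    rw [Nat.factorial_succ]
    push_cast
    ring

theorem exists_iterate_wirtingerBar {F : ℂ → ℂ} {Φ : ℂ × ℝ → ℂ}
    (hF : F =ᶠ[𝓝[≠] 0] fun z => Φ (cuspPoint z)) (hΦ : SmoothNear Φ) (n : ℕ) :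
    ∃ Ψ, wirtingerBar^[n + 1] F =ᶠ[𝓝[≠] 0] cuspTerm 0 (n + 1) Ψ ∧
      CuspOrder Ψ 2 ((-1) ^ n * n.factorial * (fderiv ℝ Φ 0 (0, 1) / 2)) := by
  induction n with
  | zero =>
    refine ⟨_, wirtingerBar_eventuallyEq_cuspTerm (n := 0) (m := 0) (Ψ := Φ)
      (hF.trans (Eventually.of_forall fun z => by simp [cuspTerm])) hΦ, ?_⟩
    have := CuspOrder.of_smoothNear hΦ (hΦ.cuspDBar_sub (0 : ℕ)) fun τ => by
      simp [cuspDBar_zero_fst]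
    simpa using this
  | succ n ih =>
    obtain ⟨Ψ, h1, h2⟩ := ih
    rw [Function.iterate_succ_apply']
    refine ⟨_, wirtingerBar_eventuallyEq_cuspTerm h1 h2.smooth, ?_⟩
    have := h2.derivation_sub (h2.smooth.cuspDBar_sub ((n + 1 : ℕ) : ℂ)) ((n + 1 : ℕ) : ℂ)
      fun τ => by simp only [cuspDBar_zero_fst]
    convert this using 1
    rw [Nat.factorial_succ]
    push_cast
    ring

/-- The first ∂̄ raises the order from 2 to 3 with coefficient factor 2/2 = 1; the later ones build
the second signed factorial. -/
theorem exists_iterate_wirtingerBar_wirtinger {F : ℂ → ℂ} {Φ : ℂ × ℝ → ℂ}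
    (hF : F =ᶠ[𝓝[≠] 0] fun z => Φ (cuspPoint z)) (hΦ : SmoothNear Φ) (m n : ℕ) :
    ∃ Ψ, wirtingerBar^[m + 1] (wirtinger^[n + 1] F) =ᶠ[𝓝[≠] 0] cuspTerm (n + 1) (m + 1) Ψ ∧
      CuspOrder Ψ 3 ((-1) ^ (m + n) * n.factorial * m.factorial *
        (fderiv ℝ Φ 0 (0, 1) / 2)) := by
  induction m with
  | zero =>
    obtain ⟨Ψ, h1, h2⟩ := exists_iterate_wirtinger hF hΦ n
    refine ⟨_, wirtingerBar_eventuallyEq_cuspTerm h1 h2.smooth, ?_⟩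
    have := h2.derivation (h2.smooth.cuspDBar_sub (0 : ℕ)) fun τ => by
      simp [cuspDBar_zero_fst]
    simpa using this
  | succ m ih =>
    obtain ⟨Ψ, h1, h2⟩ := ih
    rw [Function.iterate_succ_apply']
    refine ⟨_, wirtingerBar_eventuallyEq_cuspTerm h1 h2.smooth, ?_⟩
    have := h2.derivation_sub (h2.smooth.cuspDBar_sub ((m + 1 : ℕ) : ℂ)) ((m + 1 : ℕ) : ℂ)
      fun τ => by simp only [cuspDBar_zero_fst]
    convert this using 1
    rw [Nat.factorial_succ]
    push_cast
    ring

/-- A function with nonzero limit is Θ(1); dividing by the norm of the normalizing factor gives the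
two-sided bound. -/
theorem CuspOrder.isTheta_cuspTerm {F : ℂ → ℂ} {Ψ : ℂ × ℝ → ℂ} {k n m : ℕ} {c : ℂ}
    (h : CuspOrder Ψ k c) (hc : c ≠ 0) (hF : F =ᶠ[𝓝[≠] 0] cuspTerm n m Ψ) :
    F =Θ[𝓝[≠] 0] fun z => (‖z‖ ^ (n + m))⁻¹ * (Real.log (1 / ‖z‖) ^ k)⁻¹ := by
  have h1 := ((isEquivalent_const_iff_tendsto hc).mpr (h.tendsto_cuspTerm hF)).isTheta.trans
    (isTheta_const_const (c₂ := (1 : ℝ)) hc one_ne_zero)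
  have h2 := h1.norm_left.mul (isTheta_refl
    (fun z : ℂ => (‖z‖ ^ (n + m))⁻¹ * (Real.log (1 / ‖z‖) ^ k)⁻¹) (𝓝[≠] 0))
  simp only [one_mul] at h2
  refine isTheta_norm_left.mp (EventuallyEq.trans_isTheta ?_ h2)
  filter_upwards [eventually_log_one_div_norm_pos, self_mem_nhdsWithin] with z h3 (hz : z ≠ 0)
  have hz' : ‖z‖ ≠ 0 := norm_ne_zero_iff.mpr hz
  simp only [norm_mul, norm_pow, RCLike.norm_conj, Complex.norm_real, Real.norm_eq_abs,
    abs_of_pos h3]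
  field_simp
  ring

/-! ### The digamma function -/

theorem differentiableAt_Gamma_of_pos {x : ℝ} (hx : 0 < x) : DifferentiableAt ℝ Real.Gamma x :=
  Real.differentiableAt_Gamma fun m => ne_of_gt (lt_of_le_of_lt (by simp) hx)

theorem hasDerivAt_Gamma_of_pos {x : ℝ} (hx : 0 < x) :
    HasDerivAt Real.Gamma (Real.Gamma x * realDigamma x) x := by
  refine (differentiableAt_Gamma_of_pos hx).hasDerivAt.congr_deriv ?_
  rw [realDigamma, logDeriv_apply, mul_div_cancel₀ _ (Real.Gamma_pos_of_pos hx).ne']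

theorem realDigamma_add_one {x : ℝ} (hx : 0 < x) : realDigamma (x + 1) = realDigamma x + x⁻¹ := by
  have hG := (Real.Gamma_pos_of_pos hx).ne'
  have h1 : HasDerivAt (fun y => Real.Gamma (y + 1)) _ x :=
    (hasDerivAt_Gamma_of_pos (add_pos hx one_pos)).comp_add_const x 1
  have h2 : HasDerivAt (fun y => y * Real.Gamma y) _ x :=
    (hasDerivAt_id x).mul (hasDerivAt_Gamma_of_pos hx)
  have h3 : (fun y => Real.Gamma (y + 1)) =ᶠ[𝓝 x] fun y => y * Real.Gamma y := by
    filter_upwards [eventually_gt_nhds hx] with y hy using Real.Gamma_add_one hy.ne'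
  have h4 := h1.unique (h2.congr_of_eventuallyEq h3)
  rw [Real.Gamma_add_one hx.ne'] at h4
  have : x * Real.Gamma x ≠ 0 := mul_ne_zero hx.ne' hG
  field_simp
  simp only [id, one_mul] at h4
  apply mul_left_cancel₀ hG
  linear_combination h4

/-- Γ is logarithmically convex, and Ψ is the derivative of log Γ. -/
theorem monotoneOn_realDigamma : MonotoneOn realDigamma (Set.Ioi 0) := by
  have h := Real.convexOn_log_Gamma.monotoneOn_deriv (fun x hx =>
    ((differentiableAt_Gamma_of_pos hx).log (Real.Gamma_pos_of_pos hx).ne'))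
  refine h.congr fun x hx => ?_
  exact ((hasDerivAt_Gamma_of_pos hx).log (Real.Gamma_pos_of_pos hx).ne').deriv.trans
    (mul_div_cancel_left₀ _ (Real.Gamma_pos_of_pos hx).ne')

/-- Shifting the arguments by one, G(x) = (2Ψ(2) - Ψ(1+x) - Ψ(2-x)) + (1/x + 1/(1-x) - 2). The first
bracket is nonnegative by monotonicity, the second is positive. -/
theorem digammaG_pos {x : ℝ} (hx0 : 0 < x) (hx1 : x < 1) : 0 < digammaG x := by
  have h1 := realDigamma_add_one one_pos
  have h2 := realDigamma_add_one hx0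
  have h3 := realDigamma_add_one (sub_pos.mpr hx1)
  have h4 : realDigamma (x + 1) ≤ realDigamma (1 + 1) :=
    monotoneOn_realDigamma (by simp; linarith) (by simp) (by linarith)
  have h5 : realDigamma (1 - x + 1) ≤ realDigamma (1 + 1) :=
    monotoneOn_realDigamma (by simp; linarith) (by simp) (by linarith)
  have h6 : 1 < x⁻¹ := (one_lt_inv₀ hx0).mpr hx1
  have h7 : 1 < (1 - x)⁻¹ := (one_lt_inv₀ (by linarith)).mpr (by linarith)
  rw [inv_one] at h1
  unfold digammaG
  linarith

/-- Differentiate Γ(x) Γ(1-x) sin(πx) = π. -/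
theorem realDigamma_one_sub {x : ℝ} (hx0 : 0 < x) (hx1 : x < 1) :
    realDigamma (1 - x) - realDigamma x =
      Real.pi * Real.cos (Real.pi * x) / Real.sin (Real.pi * x) := by
  have hs : Real.sin (Real.pi * x) ≠ 0 :=
    (Real.sin_pos_of_pos_of_lt_pi (by positivity) (by nlinarith [Real.pi_pos])).ne'
  have h1x : 0 < 1 - x := by linarith
  have g1 := (Real.Gamma_pos_of_pos hx0).ne'
  have g2 := (Real.Gamma_pos_of_pos h1x).ne'
  have d1 := hasDerivAt_Gamma_of_pos hx0
  have d2 : HasDerivAt (fun y => Real.Gamma (1 - y)) _ x :=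
    (hasDerivAt_Gamma_of_pos h1x).comp_const_sub 1 x
  have d3 : HasDerivAt (fun y => Real.sin (Real.pi * y)) _ x :=
    ((hasDerivAt_id x).const_mul Real.pi).sin
  have d4 := ((d1.mul d2).mul d3).congr_of_eventuallyEq
    (f₁ := fun _ => Real.pi) (by
      filter_upwards [eventually_gt_nhds hx0, eventually_lt_nhds hx1] with y hy0 hy1
      have hs : Real.sin (Real.pi * y) ≠ 0 :=
        (Real.sin_pos_of_pos_of_lt_pi (by positivity) (by nlinarith [Real.pi_pos])).ne'
      simp only [Pi.mul_apply]
      rw [Real.Gamma_mul_Gamma_one_sub, div_mul_cancel₀ _ hs])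
  have h := d4.unique (hasDerivAt_const x Real.pi)
  simp only [id, Pi.mul_apply] at h
  have h' : Real.Gamma x * Real.Gamma (1 - x) ≠ 0 := mul_ne_zero g1 g2
  rw [eq_div_iff hs]
  apply mul_left_cancel₀ h'
  linear_combination -h

/-- The addition theorem gives S = π cot(πa) + π cot(πb), and reflection rewrites the cotangents by
Ψ. The right-hand side is the value H(0) produced by the connection formula. -/
theorem digammaG_add_digammaG {a b : ℝ} (ha0 : 0 < a) (ha1 : a < 1) (hb0 : 0 < b) (hb1 : b < 1) :
    digammaG a + digammaG b = 2 * (2 * realDigamma 1 - realDigamma a - realDigamma b) -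
      Real.pi * Real.sin (Real.pi * (a + b)) / (Real.sin (Real.pi * a) * Real.sin (Real.pi * b)) := by
  have sa : Real.sin (Real.pi * a) ≠ 0 :=
    (Real.sin_pos_of_pos_of_lt_pi (by positivity) (by nlinarith [Real.pi_pos])).ne'
  have sb : Real.sin (Real.pi * b) ≠ 0 :=
    (Real.sin_pos_of_pos_of_lt_pi (by positivity) (by nlinarith [Real.pi_pos])).ne'
  have h : Real.pi * Real.sin (Real.pi * (a + b)) /
      (Real.sin (Real.pi * a) * Real.sin (Real.pi * b)) =
      Real.pi * Real.cos (Real.pi * a) / Real.sin (Real.pi * a) +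
      Real.pi * Real.cos (Real.pi * b) / Real.sin (Real.pi * b) := by
    rw [mul_add, Real.sin_add]
    field_simp
    ring
  rw [h, ← realDigamma_one_sub ha0 ha1, ← realDigamma_one_sub hb0 hb1]
  unfold digammaG
  ring

/-! ### Euler's integral for the hypergeometric function -/

open MeasureTheory Set in
theorem integrableOn_beta_and_integral {p q : ℝ} (hp : 0 < p) (hq : 0 < q) :
    IntegrableOn (fun t : ℝ => t ^ (p - 1) * (1 - t) ^ (q - 1)) (Ioo 0 1) ∧
      ∫ t in Ioo (0 : ℝ) 1, t ^ (p - 1) * (1 - t) ^ (q - 1) =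
        Real.Gamma p * Real.Gamma q / Real.Gamma (p + q) := by
  have hp' : 0 < (p : ℂ).re := by simpa
  have hq' : 0 < (q : ℂ).re := by simpa
  have e : ∀ t ∈ Ioo (0 : ℝ) 1, (t : ℂ) ^ ((p : ℂ) - 1) * (1 - (t : ℂ)) ^ ((q : ℂ) - 1) =
      ((t ^ (p - 1) * (1 - t) ^ (q - 1) : ℝ) : ℂ) := fun t ht => by
    rw [Complex.ofReal_mul, Complex.ofReal_cpow ht.1.le, Complex.ofReal_cpow (by linarith [ht.2])]
    push_cast
    rfl
  have h1 := Complex.betaIntegral_convergent hp' hq'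
  rw [intervalIntegrable_iff_integrableOn_Ioo_of_le zero_le_one,
    integrableOn_congr_fun e measurableSet_Ioo] at h1
  have h2 := Complex.betaIntegral_eq_Gamma_mul_div _ _ hp' hq'
  rw [Complex.betaIntegral, intervalIntegral.integral_of_le zero_le_one,
    integral_Ioc_eq_integral_Ioo, setIntegral_congr_fun measurableSet_Ioo e, integral_complex_ofReal,
    ← Complex.ofReal_add, Complex.Gamma_ofReal, Complex.Gamma_ofReal, Complex.Gamma_ofReal] at h2
  exact ⟨by simpa [IntegrableOn] using h1.re, by exact_mod_cast h2⟩

/-- The region `ℂ ∖ [1, ∞)`. -/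
def cutPlane : Set ℂ := {z : ℂ | 1 - z ∈ Complex.slitPlane}

theorem isOpen_cutPlane : IsOpen cutPlane :=
  Complex.isOpen_slitPlane.preimage (by fun_prop)

theorem one_sub_mul_mem_slitPlane {z : ℂ} (hz : z ∈ cutPlane) {t : ℝ} (ht : t ∈ Set.Icc 0 1) :
    1 - t * z ∈ Complex.slitPlane := by
  have h := Complex.starConvex_one_slitPlane.add_smul_sub_mem hz ht.1 ht.2
  convert h using 1
  rw [Complex.real_smul]
  ring

/-- Euler's integral `∫₀¹ tᵖ⁻¹ (1 - t)^(q-1) (1 - t z)⁻ᵃ dt`. -/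
def eulerIntegral (a p q : ℝ) (z : ℂ) : ℂ :=
  ∫ t in Set.Ioo (0 : ℝ) 1, ((t ^ (p - 1) * (1 - t) ^ (q - 1) : ℝ) : ℂ) * (1 - t * z) ^ (-a : ℂ)

theorem mem_cutPlane_of_norm_lt_one {z : ℂ} (hz : ‖z‖ < 1) : z ∈ cutPlane := by
  have := Complex.mem_slitPlane_of_norm_lt_one (z := -z) (by simpa)
  simpa [cutPlane, sub_eq_add_neg] using this

open MeasureTheory Set in
-- Differentiation under the integral sign. By star-convexity of the slit plane about 1, the powers
-- of 1 - tz are continuous on the compact set [0,1] × closed disc, hence bounded, and the beta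
-- weight is integrable.
theorem differentiableOn_eulerIntegral (a : ℝ) {p q : ℝ} (hp : 0 < p) (hq : 0 < q) :
    DifferentiableOn ℂ (eulerIntegral a p q) cutPlane := by
  intro z₀ hz₀
  obtain ⟨r, hr, hball⟩ := Metric.nhds_basis_closedBall.mem_iff.mp (isOpen_cutPlane.mem_nhds hz₀)
  have hcont : ∀ s : ℂ, ContinuousOn (fun y : ℝ × ℂ => (1 - y.1 * y.2) ^ s)
      (Icc 0 1 ×ˢ Metric.closedBall z₀ r) := fun s =>
    ContinuousOn.cpow_const (by fun_prop)
      fun y hy => one_sub_mul_mem_slitPlane (hball hy.2) hy.1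
  have hcomp : IsCompact (Icc (0 : ℝ) 1 ×ˢ Metric.closedBall z₀ r) :=
    isCompact_Icc.prod (isCompact_closedBall z₀ r)
  have hmeas : ∀ (s : ℂ), ∀ z ∈ Metric.closedBall z₀ r,
      AEStronglyMeasurable (fun t : ℝ => (1 - t * z) ^ s) (volume.restrict (Ioo 0 1)) :=
    fun s z hz => by
      refine ContinuousOn.aestronglyMeasurable ?_ measurableSet_Ioo
      exact (hcont s).comp (f := fun t : ℝ => (t, z)) (by fun_prop)
        fun t ht => ⟨Ioo_subset_Icc_self ht, hz⟩
  obtain ⟨C₀, hC₀⟩ := hcomp.exists_bound_of_continuousOn (hcont (-a : ℂ))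
  obtain ⟨C₁, hC₁⟩ := hcomp.exists_bound_of_continuousOn (hcont (-a - 1 : ℂ))
  have hW := (integrableOn_beta_and_integral hp hq).1
  have hWm : AEStronglyMeasurable (fun t : ℝ => ((t ^ (p - 1) * (1 - t) ^ (q - 1) : ℝ) : ℂ))
      (volume.restrict (Ioo 0 1)) := hW.ofReal.aestronglyMeasurable
  have hz₀r : z₀ ∈ Metric.closedBall z₀ r := Metric.mem_closedBall_self hr.le
  have key := hasDerivAt_integral_of_dominated_loc_of_deriv_le
    (μ := volume.restrict (Ioo (0 : ℝ) 1)) (𝕜 := ℂ)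
    (F := fun z t => ((t ^ (p - 1) * (1 - t) ^ (q - 1) : ℝ) : ℂ) * (1 - t * z) ^ (-a : ℂ))
    (F' := fun z t => ((t ^ (p - 1) * (1 - t) ^ (q - 1) : ℝ) : ℂ) *
      (-a * (1 - t * z) ^ (-a - 1 : ℂ) * (-t)))
    (bound := fun t => (t ^ (p - 1) * (1 - t) ^ (q - 1)) * (|a| * C₁))
    (Metric.ball_mem_nhds z₀ hr) ?_ ?_ ?_ ?_ (hW.mul_const _) ?_
  · exact key.2.differentiableAt.differentiableWithinAt
  · filter_upwards [Metric.closedBall_mem_nhds z₀ hr] with z hz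
    exact hWm.mul (hmeas _ z hz)
  · refine hW.ofReal.mul_bdd (c := C₀) (hmeas _ z₀ hz₀r) ?_
    filter_upwards [ae_restrict_mem measurableSet_Ioo] with t ht
    exact hC₀ (t, z₀) ⟨Ioo_subset_Icc_self ht, hz₀r⟩
  · exact hWm.mul (((hmeas _ z₀ hz₀r).const_mul _).mul
      (Continuous.aestronglyMeasurable (by fun_prop)))
  · filter_upwards [ae_restrict_mem measurableSet_Ioo] with t ht z hz
    have h1 := hC₁ (t, z) ⟨Ioo_subset_Icc_self ht, Metric.ball_subset_closedBall hz⟩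
    have h2 : 0 ≤ t ^ (p - 1) * (1 - t) ^ (q - 1) :=
      mul_nonneg (Real.rpow_nonneg ht.1.le _) (Real.rpow_nonneg (by linarith [ht.2]) _)
    rw [norm_mul, norm_mul, norm_mul, Complex.norm_real, Real.norm_of_nonneg h2, norm_neg,
      norm_neg, Complex.norm_real, Complex.norm_real, Real.norm_eq_abs, Real.norm_eq_abs]
    have h3 : |t| ≤ 1 := abs_le.mpr ⟨by linarith [ht.1], ht.2.le⟩
    have h4 : 0 ≤ C₁ := (norm_nonneg _).trans h1
    calc _ ≤ t ^ (p - 1) * (1 - t) ^ (q - 1) * (|a| * C₁ * 1) := by gcongr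
      _ = _ := by ring
  · filter_upwards [ae_restrict_mem measurableSet_Ioo] with t ht z hz
    have h1 : HasDerivAt (fun z : ℂ => 1 - t * z) (-t) z := by
      simpa using ((hasDerivAt_id z).const_mul (t : ℂ)).const_sub 1
    exact (h1.cpow_const (one_sub_mul_mem_slitPlane
      (hball (Metric.ball_subset_closedBall hz)) (Ioo_subset_Icc_self ht))).const_mul _

/-! ### The hypergeometric series -/

theorem nnnorm_lt_one {z : ℂ} (hz : ‖z‖ < 1) : ‖z‖₊ < 1 := by
  rw [← NNReal.coe_lt_coe]
  simpa using hz

theorem hasSum_ordinaryHypergeometric {a b c : ℝ} (ha : 0 < a) (hb : 0 < b) (hc : 0 < c) {z : ℂ}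
    (hz : ‖z‖ < 1) :
    HasSum (fun n => ordinaryHypergeometricCoefficient (a : ℂ) b c n * z ^ n)
      (₂F₁ (a : ℂ) (b : ℂ) (c : ℂ) z) := by
  have h : ∀ {x : ℝ}, 0 < x → ∀ k : ℕ, (k : ℂ) ≠ -(x : ℂ) := fun {x} hx k h => by
    have := congrArg Complex.re h
    simp at this
    linarith [(Nat.cast_nonneg k : (0 : ℝ) ≤ k)]
  have hr := ordinaryHypergeometricSeries_radius_eq_one ℂ (a : ℂ) b c
    fun k => ⟨h ha k, h hb k, h hc k⟩
  have hs := (ordinaryHypergeometricSeries ℂ (a : ℂ) b c).hasSum (x := z) (by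
    rw [hr]; simpa [Metric.eball, edist_zero_right, enorm_eq_nnnorm] using nnnorm_lt_one hz)
  simp only [ordinaryHypergeometricSeries_apply_eq, smul_eq_mul] at hs
  exact hs

theorem ordinaryHypergeometricCoefficient_succ {a b c : ℝ} (hc : 0 < c) (n : ℕ) :
    ordinaryHypergeometricCoefficient (a : ℂ) b c (n + 1) * ((n + 1) * (c + n)) =
      ordinaryHypergeometricCoefficient (a : ℂ) b c n * ((a + n) * (b + n)) := by
  have h1 : ((c : ℂ) + n) ≠ 0 := by
    have : c + n ≠ 0 := by positivity
    exact_mod_cast this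
  have h2 : ((n : ℂ) + 1) ≠ 0 := Nat.cast_add_one_ne_zero n
  simp only [ordinaryHypergeometricCoefficient, ascPochhammer_succ_eval, Nat.factorial_succ,
    mul_inv]
  push_cast
  field_simp

theorem conj_ordinaryHypergeometricCoefficient {a b c : ℝ} (hc : 0 < c) (n : ℕ) :
    starRingEnd ℂ (ordinaryHypergeometricCoefficient (a : ℂ) b c n) =
      ordinaryHypergeometricCoefficient (a : ℂ) b c n := by
  induction n with
  | zero => simp [ordinaryHypergeometricCoefficient]
  | succ n ih =>
    have h1 : (((n : ℂ) + 1) * (c + n)) ≠ 0 := by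
      have : ((n : ℝ) + 1) * (c + n) ≠ 0 := by positivity
      exact_mod_cast this
    have h2 := ordinaryHypergeometricCoefficient_succ (a := a) (b := b) hc n
    generalize ordinaryHypergeometricCoefficient (a : ℂ) b c (n + 1) = X at *
    generalize ordinaryHypergeometricCoefficient (a : ℂ) b c n = Y at *
    have h3 := congrArg (starRingEnd ℂ) h2
    simp only [map_mul, map_add, map_one, Complex.conj_natCast, Complex.conj_ofReal, ih] at h3
    exact mul_right_cancel₀ h1 (h3.trans h2.symm)

theorem ordinaryHypergeometric_conj {a b c : ℝ} (ha : 0 < a) (hb : 0 < b) (hc : 0 < c) {z : ℂ}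
    (hz : ‖z‖ < 1) :
    ₂F₁ (a : ℂ) (b : ℂ) (c : ℂ) (starRingEnd ℂ z) =
      starRingEnd ℂ (₂F₁ (a : ℂ) (b : ℂ) (c : ℂ) z) := by
  have h1 := hasSum_ordinaryHypergeometric ha hb hc (z := starRingEnd ℂ z) (by simpa)
  have h2 := (hasSum_ordinaryHypergeometric ha hb hc hz).mapL
    ((Complex.conjCLE : ℂ →L[ℝ] ℂ))
  refine h1.unique (h2.congr_fun fun n => ?_)
  have h3 := conj_ordinaryHypergeometricCoefficient (a := a) (b := b) hc n
  change _ = starRingEnd ℂ (ordinaryHypergeometricCoefficient (a : ℂ) b c n * z ^ n)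
  generalize ordinaryHypergeometricCoefficient (a : ℂ) b c n = X at *
  rw [map_mul, map_pow, h3]

theorem hasSum_one_sub_cpow_neg (a : ℂ) {w : ℂ} (hw : ‖w‖ < 1) :
    HasSum (fun n => (n.factorial : ℂ)⁻¹ * (ascPochhammer ℂ n).eval a * w ^ n)
      ((1 - w) ^ (-a)) := by
  have h := (Complex.one_div_one_sub_cpow_hasFPowerSeriesOnBall_zero a).hasSum (y := w) (by
    simpa [Metric.eball, edist_zero_right, enorm_eq_nnnorm] using nnnorm_lt_one hw)
  simp only [zero_add, one_div, ← Complex.cpow_neg, FormalMultilinearSeries.ofScalars_apply_eq,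
    smul_eq_mul] at h
  have hc : ∀ n : ℕ, (n.factorial : ℂ)⁻¹ * (ascPochhammer ℂ n).eval a =
      Ring.choose (a + n - 1) n := fun n => by
    have h1 := Ring.factorial_nsmul_multichoose_eq_ascPochhammer a n
    rw [Polynomial.ascPochhammer_smeval_eq_eval] at h1
    have h2 : (n.factorial : ℂ) ≠ 0 := by exact_mod_cast n.factorial_ne_zero
    rw [← h1, Ring.choose, nsmul_eq_mul, inv_mul_cancel_left₀ h2]
    congr 1
    ring
  simp only [hc]
  exact h

open MeasureTheory Set in
-- Expand (1 - tz)⁻ᵃ binomially and integrate termwise: B(p+n, q) / B(p, q) = (p)ₙ / (p+q)ₙ. The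
-- interchange is justified by tⁿ ≤ 1 and absolute convergence of the binomial series at z.
theorem eulerIntegral_eq_mul_ordinaryHypergeometric {a p q : ℝ} (ha : 0 < a) (hp : 0 < p)
    (hq : 0 < q) {z : ℂ} (hz : ‖z‖ < 1) :
    eulerIntegral a p q z =
      eulerBeta p q * ₂F₁ (a : ℂ) (p : ℂ) ((p + q : ℝ) : ℂ) z := by
  set W : ℝ → ℝ := fun t => t ^ (p - 1) * (1 - t) ^ (q - 1) with hWdef
  set e : ℕ → ℂ := fun n => (n.factorial : ℂ)⁻¹ * (ascPochhammer ℂ n).eval (a : ℂ) with he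
  have hW := (integrableOn_beta_and_integral hp hq).1
  have hWn : ∀ n : ℕ, ∀ t ∈ Ioo (0 : ℝ) 1, W t * t ^ n = t ^ (p + n - 1) * (1 - t) ^ (q - 1) :=
    fun n t ht => by
      rw [show p + n - 1 = p - 1 + n by ring, Real.rpow_add_natCast ht.1.ne']
      simp only [hWdef]; ring
  have hint : ∀ n : ℕ, IntegrableOn (fun t => W t * t ^ n) (Ioo 0 1) ∧
      ∫ t in Ioo (0 : ℝ) 1, W t * t ^ n = eulerBeta (p + n) q := fun n => by
    have h := integrableOn_beta_and_integral (p := p + n) (by positivity) hq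
    refine ⟨(integrableOn_congr_fun (hWn n) measurableSet_Ioo).mpr h.1, ?_⟩
    rw [setIntegral_congr_fun measurableSet_Ioo (hWn n), h.2, eulerBeta]
  have hW0 : ∀ t ∈ Ioo (0 : ℝ) 1, 0 ≤ W t := fun t ht =>
    mul_nonneg (Real.rpow_nonneg ht.1.le _) (Real.rpow_nonneg (by linarith [ht.2]) _)
  have hF : ∀ n (t : ℝ), ((W t : ℝ) : ℂ) * (e n * (t * z) ^ n) =
      ((W t * t ^ n : ℝ) : ℂ) * (e n * z ^ n) := fun n t => by
    push_cast; ring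
  have hsum := hasSum_integral_of_summable_integral_norm (μ := volume.restrict (Ioo (0 : ℝ) 1))
    (F := fun n t => ((W t : ℝ) : ℂ) * (e n * (t * z) ^ n)) ?_ ?_
  · have e1 : ∫ t in Ioo (0 : ℝ) 1, (∑' n, ((W t : ℝ) : ℂ) * (e n * (t * z) ^ n)) =
        eulerIntegral a p q z := by
      refine setIntegral_congr_fun measurableSet_Ioo fun t ht => ?_
      have htz : ‖(t : ℂ) * z‖ < 1 := by
        rw [norm_mul, Complex.norm_real, Real.norm_of_nonneg ht.1.le]
        nlinarith [ht.1, ht.2, norm_nonneg z]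
      exact ((hasSum_one_sub_cpow_neg a htz).mul_left ((W t : ℝ) : ℂ)).tsum_eq
    rw [e1] at hsum
    refine hsum.unique (((hasSum_ordinaryHypergeometric ha hp (add_pos hp hq) hz).mul_left
      ((eulerBeta p q : ℝ) : ℂ)).congr_fun fun n => ?_)
    simp only [hF]
    rw [integral_mul_const, integral_complex_ofReal, (hint n).2]
    have hG : ∀ {x : ℝ}, 0 < x → (ascPochhammer ℂ n).eval (x : ℂ) =
        ((Real.Gamma (x + n) / Real.Gamma x : ℝ) : ℂ) := fun {x} hx => by
      rw [← Complex.Gamma_add_nat_div_Gamma_eq (x : ℂ) (fun k h => by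
        have := congrArg Complex.re h
        simp at this
        linarith [(Nat.cast_nonneg k : (0 : ℝ) ≤ k)])]
      rw [← Complex.ofReal_natCast, ← Complex.ofReal_add, Complex.Gamma_ofReal,
        Complex.Gamma_ofReal, Complex.ofReal_div]
    have g1 := (Real.Gamma_pos_of_pos hp).ne'
    have g2 := (Real.Gamma_pos_of_pos (add_pos hp hq)).ne'
    have g3 := (Real.Gamma_pos_of_pos (show 0 < p + q + n by positivity)).ne'
    have key : eulerBeta (p + n) q = eulerBeta p q *
        ((Real.Gamma (p + n) / Real.Gamma p) *
          (Real.Gamma (p + q + n) / Real.Gamma (p + q))⁻¹) := by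
      simp only [eulerBeta]
      rw [show p + n + q = p + q + n by ring]
      field_simp
    simp only [ordinaryHypergeometricCoefficient, hG hp, hG (add_pos hp hq), he]
    rw [key]
    push_cast
    ring
  · intro n
    simp only [hF]
    exact ((hint n).1.ofReal).mul_const _
  · have h1 : Summable fun n => ‖e n * z ^ n‖ := (hasSum_one_sub_cpow_neg a hz).summable.norm
    refine Summable.of_nonneg_of_le (fun n => integral_nonneg fun t => norm_nonneg _) (fun n => ?_)
      (h1.mul_left (∫ t in Ioo (0 : ℝ) 1, W t))
    rw [← integral_mul_const]
    refine setIntegral_mono_on ?_ (hW.mul_const _) measurableSet_Ioo fun t ht => ?_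
    · simp only [hF]
      exact (((hint n).1.ofReal).mul_const _).norm
    · rw [hF, norm_mul, Complex.norm_real, Real.norm_of_nonneg
        (mul_nonneg (hW0 t ht) (pow_nonneg ht.1.le n))]
      have h2 : t ^ n ≤ 1 := pow_le_one₀ ht.1.le ht.2.le
      have h3 := hW0 t ht
      calc _ ≤ W t * 1 * ‖e n * z ^ n‖ := by gcongr
        _ = _ := by ring

theorem eulerBeta_pos {p q : ℝ} (hp : 0 < p) (hq : 0 < q) : 0 < eulerBeta p q :=
  div_pos (mul_pos (Real.Gamma_pos_of_pos hp) (Real.Gamma_pos_of_pos hq))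
    (Real.Gamma_pos_of_pos (add_pos hp hq))

/-- The chosen function has its defining properties because a candidate exists, namely Euler's
integral divided by B(b, c-b). This covers both c = 1 and c = a + b. -/
theorem gaussF_spec {a b c : ℝ} (ha : 0 < a) (hb : 0 < b) (hbc : b < c) :
    AnalyticOnNhd ℂ (gaussF a b c) cutPlane ∧
      ∀ z : ℂ, ‖z‖ < 1 → gaussF a b c z = ₂F₁ (a : ℂ) (b : ℂ) (c : ℂ) z := by
  refine Classical.epsilon_spec (p := fun f : ℂ → ℂ =>
    AnalyticOnNhd ℂ f {z : ℂ | 1 - z ∈ Complex.slitPlane} ∧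
      ∀ z : ℂ, ‖z‖ < 1 → f z = ₂F₁ (a : ℂ) (b : ℂ) (c : ℂ) z)
    ⟨fun z => ((eulerBeta b (c - b) : ℝ) : ℂ)⁻¹ * eulerIntegral a b (c - b) z, ?_, ?_⟩
  · exact ((differentiableOn_eulerIntegral a hb (sub_pos.mpr hbc)).const_mul _).analyticOnNhd
      isOpen_cutPlane
  · intro z hz
    have h : ((eulerBeta b (c - b) : ℝ) : ℂ) ≠ 0 := by
      exact_mod_cast (eulerBeta_pos hb (sub_pos.mpr hbc)).ne'
    beta_reduce
    rw [eulerIntegral_eq_mul_ordinaryHypergeometric ha hb (sub_pos.mpr hbc) hz,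
      inv_mul_cancel_left₀ h, add_sub_cancel]

/-! ### The hypergeometric equation and the logarithmic connection formula -/

theorem hasFPowerSeriesOnBall_ofScalars {c : ℕ → ℂ} {f : ℂ → ℂ}
    (h : ∀ z : ℂ, ‖z‖ < 1 → HasSum (fun n => c n * z ^ n) (f z)) :
    HasFPowerSeriesOnBall f (FormalMultilinearSeries.ofScalars ℂ c) 0 1 where
  r_le := by
    refine ENNReal.le_of_forall_nnreal_lt fun r hr => ?_
    refine FormalMultilinearSeries.le_radius_of_summable _ ?_
    have hr1 : ‖((r : ℝ) : ℂ)‖ < 1 := by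
      rw [Complex.norm_real, Real.norm_of_nonneg r.coe_nonneg]
      exact_mod_cast hr
    refine Summable.congr (h _ hr1).summable.norm fun n => ?_
    rw [norm_mul, norm_pow, Complex.norm_real, Real.norm_of_nonneg r.coe_nonneg,
      FormalMultilinearSeries.ofScalars_norm]
  r_pos := one_pos
  hasSum := fun {y} hy => by
    simp only [FormalMultilinearSeries.ofScalars_apply_eq, smul_eq_mul, zero_add]
    refine h y ?_
    have : ‖y‖₊ < 1 := by simpa [Metric.eball, edist_zero_right, enorm_eq_nnnorm] using hy
    exact_mod_cast this

/-- The operator θ = z d/dz multiplies the n-th coefficient by n, which spares index shifts in the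
differential equation. -/
theorem hasSum_mul_deriv {c : ℕ → ℂ} {f : ℂ → ℂ}
    (h : ∀ z : ℂ, ‖z‖ < 1 → HasSum (fun n => c n * z ^ n) (f z)) {z : ℂ} (hz : ‖z‖ < 1) :
    HasSum (fun n : ℕ => n * c n * z ^ n) (z * deriv f z) := by
  have hf := hasFPowerSeriesOnBall_ofScalars h
  have hzm : ‖z‖₊ < 1 := nnnorm_lt_one hz
  have h1 := hf.fderiv.hasSum (y := z)
    (by simpa [Metric.eball, edist_zero_right, enorm_eq_nnnorm] using hzm)
  have h2 := h1.mapL (ContinuousLinearMap.apply ℂ ℂ z)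
  simp only [ContinuousLinearMap.apply_apply, FormalMultilinearSeries.derivSeries_apply_diag,
    FormalMultilinearSeries.ofScalars_apply_eq, zero_add, nsmul_eq_mul, smul_eq_mul] at h2
  have h3 : fderiv ℂ f z z = z * deriv f z := by
    rw [← fderiv_apply_one_eq_deriv, ← smul_eq_mul, ← map_smul, smul_eq_mul, mul_one]
  rw [h3] at h2
  rw [← hasSum_nat_add_iff' 1]
  simp only [Finset.range_one, Finset.sum_singleton, Nat.cast_zero, zero_mul, sub_zero]
  refine h2.congr_fun fun n => ?_
  push_cast
  ring

theorem analyticAt_of_hasSum {c : ℕ → ℂ} {f : ℂ → ℂ}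
    (h : ∀ z : ℂ, ‖z‖ < 1 → HasSum (fun n => c n * z ^ n) (f z)) {z : ℂ} (hz : ‖z‖ < 1) :
    AnalyticAt ℂ f z :=
  (hasFPowerSeriesOnBall_ofScalars h).analyticAt_of_mem (by
    simpa [Metric.eball, edist_zero_right, enorm_eq_nnnorm] using nnnorm_lt_one hz)

/-- The hypergeometric differential equation. -/
theorem hypergeometric_ode {a b c : ℝ} (ha : 0 < a) (hb : 0 < b) (hc : 0 < c) {f : ℂ → ℂ}
    (hf : ∀ z : ℂ, ‖z‖ < 1 → f z = ₂F₁ (a : ℂ) (b : ℂ) (c : ℂ) z) {z : ℂ} (hz : ‖z‖ < 1)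
    (hz0 : z ≠ 0) :
    z * (1 - z) * deriv (deriv f) z + (c - (a + b + 1) * z) * deriv f z - a * b * f z = 0 := by
  set k : ℕ → ℂ := ordinaryHypergeometricCoefficient (a : ℂ) b c with hk
  have hsucc : ∀ n, k (n + 1) * ((n + 1) * (c + n)) = k n * ((a + n) * (b + n)) :=
    ordinaryHypergeometricCoefficient_succ hc
  have h0 : ∀ z : ℂ, ‖z‖ < 1 → HasSum (fun n => k n * z ^ n) (f z) := fun z hz => by
    rw [hf z hz]
    exact hasSum_ordinaryHypergeometric ha hb hc hz
  clear_value k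
  have h1 : ∀ z : ℂ, ‖z‖ < 1 → HasSum (fun n : ℕ => n * k n * z ^ n) (z * deriv f z) :=
    fun z hz => hasSum_mul_deriv h0 hz
  have h2 := hasSum_mul_deriv h1 hz
  have hd : deriv (fun ζ => ζ * deriv f ζ) z = deriv f z + z * deriv (deriv f) z := by
    have := (hasDerivAt_id z).mul
      (analyticAt_of_hasSum h0 hz).deriv.differentiableAt.hasDerivAt
    exact this.deriv.trans (by simp)
  rw [hd] at h2
  -- `hA` expands θ(θ + c - 1)f and `hB` expands z(θ + a)(θ + b)f. The coefficient recursion matches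
  -- them after a shift by one, the zeroth coefficient of `hA` being zero.
  have hA := h2.add ((h1 z hz).mul_left ((c : ℂ) - 1))
  have hB := ((h2.add ((h1 z hz).mul_left ((a : ℂ) + b))).add
    ((h0 z hz).mul_left ((a : ℂ) * b))).mul_left z
  rw [← hasSum_nat_add_iff' 1] at hA
  have h3 := hA.unique (hB.congr_fun fun n => by
    push_cast
    linear_combination z ^ (n + 1) * hsucc n)
  simp only [Finset.range_one, Finset.sum_singleton, Nat.cast_zero, zero_mul, mul_zero, add_zero,
    sub_zero] at h3
  apply mul_left_cancel₀ hz0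
  linear_combination h3

/-- If `f` and `g` solve the hypergeometric equation with third parameter `1`, then
`z (1 - z)^(a + b)` times their Wronskian is constant. -/
theorem hasDerivAt_wronskian {a b : ℝ} {f g : ℂ → ℂ} {z : ℂ} (hf : AnalyticAt ℂ f z)
    (hg : AnalyticAt ℂ g z) (hz : 1 - z ∈ Complex.slitPlane)
    (ef : z * (1 - z) * deriv (deriv f) z + (1 - (a + b + 1) * z) * deriv f z
      - a * b * f z = 0)
    (eg : z * (1 - z) * deriv (deriv g) z + (1 - (a + b + 1) * z) * deriv g z
      - a * b * g z = 0) :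
    HasDerivAt (fun ζ => ζ * (1 - ζ) ^ (a + b : ℂ) * (f ζ * deriv g ζ - deriv f ζ * g ζ)) 0 z := by
  have d1 := hf.differentiableAt.hasDerivAt
  have d2 := hg.differentiableAt.hasDerivAt
  have d3 := hf.deriv.differentiableAt.hasDerivAt
  have d4 := hg.deriv.differentiableAt.hasDerivAt
  have d5 := ((hasDerivAt_id z).const_sub 1).cpow_const (c := (a + b : ℂ)) hz
  have h := (((hasDerivAt_id z).mul d5).mul ((d1.mul d4).sub (d3.mul d2)))
  refine h.congr_deriv ?_
  have hne : (1 - z) ≠ 0 := Complex.slitPlane_ne_zero hz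
  have hp : (1 - z) ^ (a + b : ℂ) = (1 - z) ^ (a + b - 1 : ℂ) * (1 - z) := by
    rw [Complex.cpow_sub _ _ hne, Complex.cpow_one, div_mul_cancel₀ _ hne]
  simp only [id, Pi.mul_apply, Pi.sub_apply, hp]
  -- The derivative is (1 - z)^(a+b-1) times f·(equation for g) - g·(equation for f).
  linear_combination (1 - z) ^ (a + b - 1 : ℂ) * (f z * eg - g z * ef)

theorem isPreconnected_ball_inter_slitPlane {r : ℝ} (hr : 0 < r) :
    IsPreconnected (Metric.ball (0 : ℂ) r ∩ Complex.slitPlane) := by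
  have h0 : ((r / 2 : ℝ) : ℂ) ∈ Metric.ball (0 : ℂ) r ∩ Complex.slitPlane := by
    refine ⟨?_, Complex.ofReal_mem_slitPlane.mpr (by positivity)⟩
    rw [mem_ball_zero_iff, Complex.norm_real, Real.norm_of_nonneg (by positivity)]
    linarith
  have h1 : StarConvex ℝ ((r / 2 : ℝ) : ℂ) (Metric.ball (0 : ℂ) r ∩ Complex.slitPlane) :=
    ((convex_ball _ _).starConvex h0.1).inter
      (Complex.starConvex_ofReal_slitPlane (by positivity))
  exact (h1.isPathConnected h0).isConnected.isPreconnected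

/-- Near the cusp, `F(a, b, a + b; 1 - z)` is `F(a, b, 1; z)` times a multiple of `log z` plus a
holomorphic function. -/
theorem exists_log_expansion {a b : ℝ} (ha : 0 < a) (hb : 0 < b) (hb1 : b < 1) :
    ∃ r : ℝ, 0 < r ∧ r ≤ 1 ∧ ∃ (K : ℂ) (Q : ℂ → ℂ), DifferentiableOn ℂ Q (Metric.ball 0 r) ∧
      (∀ z ∈ Metric.ball (0 : ℂ) r, gaussF a b 1 z ≠ 0) ∧
      ∀ z ∈ Metric.ball (0 : ℂ) r ∩ Complex.slitPlane,
        gaussF a b (a + b) (1 - z) = gaussF a b 1 z * (K * Complex.log z + Q z) := by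
  obtain ⟨f_an, f_eq⟩ := gaussF_spec ha hb hb1
  obtain ⟨g_an, g_eq⟩ := gaussF_spec (c := a + b) ha hb (by linarith)
  rw [Complex.ofReal_one] at f_an f_eq
  rw [Complex.ofReal_add] at g_an g_eq
  set f := gaussF a b 1
  set g := gaussF a b (a + b)
  set P : ℂ → ℂ := fun z => g (1 - z) with hP
  have P_an : AnalyticOnNhd ℂ P Complex.slitPlane := fun z hz =>
    (g_an (1 - z) (by simpa [cutPlane] using hz)).comp (by fun_prop)
  have hball1 : ∀ z : ℂ, ‖z‖ < 1 → AnalyticAt ℂ f z := fun z hz =>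
    f_an z (mem_cutPlane_of_norm_lt_one hz)
  have f0 : f 0 = 1 := by rw [f_eq 0 (by simp), ordinaryHypergeometric_zero]
  obtain ⟨r₀, hr₀, hf₀⟩ := Metric.eventually_nhds_iff_ball.mp
    ((hball1 0 (by simp)).continuousAt.eventually_ne (y := 0) (by rw [f0]; exact one_ne_zero))
  set r := min r₀ 1 with hr_def
  have hr : 0 < r := lt_min hr₀ one_pos
  have hr1 : r ≤ 1 := min_le_right _ _
  have hfne : ∀ z ∈ Metric.ball (0 : ℂ) r, f z ≠ 0 := fun z hz =>
    hf₀ z (Metric.ball_subset_ball (min_le_left _ _) hz)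
  have hnorm : ∀ z ∈ Metric.ball (0 : ℂ) r, ‖z‖ < 1 := fun z hz =>
    (mem_ball_zero_iff.mp hz).trans_le hr1
  -- constancy of the Wronskian
  set U : Set ℂ := Metric.ball 0 r ∩ Metric.ball 1 1 with hU
  have U_open : IsOpen U := Metric.isOpen_ball.inter Metric.isOpen_ball
  have U_conn : IsPreconnected U := ((convex_ball _ _).inter (convex_ball _ _)).isPreconnected
  have U_slit : ∀ z ∈ U, z ∈ Complex.slitPlane ∧ 1 - z ∈ Complex.slitPlane ∧ ‖1 - z‖ < 1 :=
    fun z hz => by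
      have h1 : ‖1 - z‖ < 1 := by
        rw [← dist_eq_norm, dist_comm]; exact hz.2
      refine ⟨?_, mem_cutPlane_of_norm_lt_one (hnorm z hz.1), h1⟩
      simpa [cutPlane] using mem_cutPlane_of_norm_lt_one h1
  have hP' : ∀ z ∈ Complex.slitPlane, deriv P z = -deriv g (1 - z) := fun z hz =>
    deriv_comp_const_sub (f := g) (1 : ℂ) z
  have hP'' : ∀ z ∈ Complex.slitPlane, deriv (deriv P) z = deriv (deriv g) (1 - z) :=
    fun z hz => by
      have : deriv P =ᶠ[𝓝 z] fun ζ => -deriv g (1 - ζ) := by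
        filter_upwards [Complex.isOpen_slitPlane.mem_nhds hz] with ζ hζ using hP' ζ hζ
      rw [this.deriv_eq, deriv.fun_neg, deriv_comp_const_sub, neg_neg]
  have hW : ∀ z ∈ U, HasDerivAt (fun ζ => ζ * (1 - ζ) ^ (a + b : ℂ) *
      (f ζ * deriv P ζ - deriv f ζ * P ζ)) 0 z := fun z hz => by
    obtain ⟨h1, h2, h3⟩ := U_slit z hz
    refine hasDerivAt_wronskian (hball1 z (hnorm z hz.1)) (P_an z h1) h2 ?_ ?_
    · have := hypergeometric_ode ha hb one_pos (f := f) (by simpa using f_eq) (hnorm z hz.1)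
        (Complex.slitPlane_ne_zero h1)
      simpa using this
    -- The reflection z ↦ 1 - z sends the third parameter c to a + b + 1 - c, here a + b to 1.
    · have := hypergeometric_ode ha hb (add_pos ha hb) (f := g) (by simpa using g_eq) h3
        (Complex.slitPlane_ne_zero h2)
      rw [hP' z h1, hP'' z h1, hP]
      push_cast at this
      linear_combination this
  obtain ⟨K, hK⟩ := U_open.exists_is_const_of_deriv_eq_zero U_conn
    (fun z hz => (hW z hz).differentiableAt.differentiableWithinAt) (fun z hz => (hW z hz).deriv)
  -- a primitive of the derivative of the quotient
  set u : ℂ → ℂ := fun z => ((1 - z) ^ (a + b : ℂ) * f z ^ 2)⁻¹ with hu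
  have hEne : ∀ z ∈ Metric.ball (0 : ℂ) r, (1 - z) ^ (a + b : ℂ) ≠ 0 := fun z hz =>
    (Complex.cpow_ne_zero_iff_of_exponent_ne_zero (by
      have : a + b ≠ 0 := by positivity
      exact_mod_cast this)).mpr
      (Complex.slitPlane_ne_zero (mem_cutPlane_of_norm_lt_one (hnorm z hz)))
  have u_diff : DifferentiableOn ℂ u (Metric.ball 0 r) := fun z hz => by
    refine DifferentiableAt.differentiableWithinAt (DifferentiableAt.inv (DifferentiableAt.mul ?_
      ((hball1 z (hnorm z hz)).differentiableAt.pow 2)) (mul_ne_zero (hEne z hz)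
      (pow_ne_zero 2 (hfne z hz))))
    exact DifferentiableAt.cpow_const (by fun_prop) (mem_cutPlane_of_norm_lt_one (hnorm z hz))
  have u0 : u 0 = 1 := by simp [hu, f0]
  -- The Wronskian identity reads (P/f)' = K u(z)/z. As u(0) = 1, u(z)/z is 1/z plus `dslope u 0 z`:
  -- the first integrates to log z, the second has a holomorphic primitive on the disc.
  have q_diff : DifferentiableOn ℂ (dslope u 0) (Metric.ball 0 r) :=
    (Complex.differentiableOn_dslope (Metric.ball_mem_nhds 0 hr)).mpr u_diff
  obtain ⟨Q₀, hQ₀⟩ := q_diff.isExactOn_ball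
  have hconst : ∀ z ∈ U, HasDerivAt (fun ζ => P ζ / f ζ - (K * Complex.log ζ + K * Q₀ ζ)) 0 z :=
    fun z hz => by
      obtain ⟨h1, h2, h3⟩ := U_slit z hz
      have hz0 : z ≠ 0 := Complex.slitPlane_ne_zero h1
      have hE := hEne z hz.1
      have d := (((P_an z h1).differentiableAt.hasDerivAt.div
        (hball1 z (hnorm z hz.1)).differentiableAt.hasDerivAt (hfne z hz.1))).sub
        (((Complex.hasDerivAt_log h1).const_mul K).add ((hQ₀ z hz.1).const_mul K))
      refine d.congr_deriv ?_
      have h4 : dslope u 0 z = (u z - 1) / z := by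
        rw [dslope_of_ne _ hz0, slope_def_field, u0, sub_zero]
      have hf' := hfne z hz.1
      rw [h4, hu, ← hK z hz]
      field_simp
      ring
  obtain ⟨k, hk⟩ := U_open.exists_is_const_of_deriv_eq_zero U_conn
    (fun z hz => (hconst z hz).differentiableAt.differentiableWithinAt)
    (fun z hz => (hconst z hz).deriv)
  refine ⟨r, hr, hr1, K, fun z => K * Q₀ z + k, ?_, hfne, ?_⟩
  · exact fun z hz => (((hQ₀ z hz).const_mul K).add_const k).differentiableAt.differentiableWithinAt
  have hV_open : IsOpen (Metric.ball (0 : ℂ) r ∩ Complex.slitPlane) :=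
    Metric.isOpen_ball.inter Complex.isOpen_slitPlane
  have hR : AnalyticOnNhd ℂ (fun z => f z * (K * Complex.log z + (K * Q₀ z + k)))
      (Metric.ball (0 : ℂ) r ∩ Complex.slitPlane) := by
    refine DifferentiableOn.analyticOnNhd (fun z hz => ?_) hV_open
    exact ((hball1 z (hnorm z hz.1)).differentiableAt.mul
      (((Complex.hasDerivAt_log hz.2).const_mul K).add
        (((hQ₀ z hz.1).const_mul K).add_const k)).differentiableAt).differentiableWithinAt
  have h0 : ((r / 2 : ℝ) : ℂ) ∈ U := by
    constructor
    · rw [mem_ball_zero_iff, Complex.norm_real, Real.norm_of_nonneg (by positivity)]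
      linarith
    · rw [mem_ball_iff_norm, ← Complex.ofReal_one, ← Complex.ofReal_sub, Complex.norm_real,
        Real.norm_eq_abs, abs_lt]
      constructor <;> linarith
  -- The identity theorem carries the formula from the lens to the slit disc.
  refine fun z hz => (P_an.mono Set.inter_subset_right).eqOn_of_preconnected_of_eventuallyEq hR
    (isPreconnected_ball_inter_slitPlane hr) ⟨h0.1, (U_slit _ h0).1⟩ ?_ hz
  filter_upwards [U_open.mem_nhds h0] with z hz
  have h1 := hk z hz
  have hf' := hfne z hz.1
  rw [sub_eq_iff_eq_add, div_eq_iff hf'] at h1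
  rw [h1]
  ring

/-! ### The Mellin transform of Euler's integral -/

open MeasureTheory Set in
-- Substitute x = t / (1 - t) in the beta integral.
theorem integrableOn_beta_Ioi_and_integral {p q : ℝ} (hp : 0 < p) (hq : 0 < q) :
    IntegrableOn (fun x : ℝ => x ^ (p - 1) * (1 + x) ^ (-(p + q))) (Ioi 0) ∧
      ∫ x in Ioi (0 : ℝ), x ^ (p - 1) * (1 + x) ^ (-(p + q)) = eulerBeta p q := by
  have himg : (fun t : ℝ => t / (1 - t)) '' Ioo 0 1 = Ioi 0 := by
    ext x
    constructor
    · rintro ⟨t, ht, rfl⟩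
      exact div_pos ht.1 (by linarith [ht.2])
    · intro (hx : 0 < x)
      refine ⟨x / (1 + x), ⟨by positivity, by rw [div_lt_one (by positivity)]; linarith⟩, ?_⟩
      field_simp
      ring
  have hderiv : ∀ t ∈ Ioo (0 : ℝ) 1,
      HasDerivWithinAt (fun t : ℝ => t / (1 - t)) (1 / (1 - t) ^ 2) (Ioo 0 1) t := fun t ht => by
    have h1 : 1 - t ≠ 0 := by linarith [ht.2]
    have := (hasDerivAt_id t).div ((hasDerivAt_id t).const_sub 1) h1
    refine (this.congr_deriv ?_).hasDerivWithinAt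
    simp
  have hinj : InjOn (fun t : ℝ => t / (1 - t)) (Ioo 0 1) := fun s hs t ht h => by
    have h1 : 1 - t ≠ 0 := by linarith [ht.2]
    have h2 : 1 - s ≠ 0 := by linarith [hs.2]
    simp only at h
    rw [div_eq_div_iff h2 h1] at h
    linarith
  have hcongr : ∀ t ∈ Ioo (0 : ℝ) 1, |1 / (1 - t) ^ 2| •
      ((t / (1 - t)) ^ (p - 1) * (1 + t / (1 - t)) ^ (-(p + q))) =
      t ^ (p - 1) * (1 - t) ^ (q - 1) := fun t ht => by
    have h1 : 0 < 1 - t := by linarith [ht.2]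
    have h2 : 1 + t / (1 - t) = (1 - t)⁻¹ := by field_simp; ring
    rw [abs_of_pos (by positivity), h2, Real.div_rpow ht.1.le h1.le, Real.inv_rpow h1.le,
      Real.rpow_neg h1.le, inv_inv, smul_eq_mul, ← Real.rpow_natCast (1 - t) 2]
    have e : (1 - t) ^ (p + q) =
        (1 - t) ^ (q - 1) * (1 - t) ^ (p - 1) * (1 - t) ^ ((2 : ℕ) : ℝ) := by
      rw [← Real.rpow_add h1, ← Real.rpow_add h1]
      congr 1
      push_cast
      ring
    rw [e]
    field_simp
  have hI := integrableOn_beta_and_integral hp hq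
  rw [← himg, integrableOn_image_iff_integrableOn_abs_deriv_smul measurableSet_Ioo hderiv hinj,
    integral_image_eq_integral_abs_deriv_smul measurableSet_Ioo hderiv hinj,
    integrableOn_congr_fun hcongr measurableSet_Ioo,
    setIntegral_congr_fun measurableSet_Ioo hcongr]
  exact hI

open MeasureTheory Set in
theorem integrableOn_beta_Ioi_scaled_and_integral {p q A t : ℝ} (hp : 0 < p) (hq : 0 < q)
    (hA : 0 < A) (ht : 0 < t) :
    IntegrableOn (fun x : ℝ => x ^ (p - 1) * (A + t * x) ^ (-(p + q))) (Ioi 0) ∧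
      ∫ x in Ioi (0 : ℝ), x ^ (p - 1) * (A + t * x) ^ (-(p + q)) =
        A ^ (-q) * t ^ (-p) * eulerBeta p q := by
  have h := integrableOn_beta_Ioi_and_integral hp hq
  have hs : 0 < t / A := by positivity
  have hcongr : ∀ x ∈ Ioi (0 : ℝ), x ^ (p - 1) * (A + t * x) ^ (-(p + q)) =
      (A ^ (-q) * t ^ (-p) * (t / A)) *
        ((t / A * x) ^ (p - 1) * (1 + t / A * x) ^ (-(p + q))) := fun x (hx : 0 < x) => by
    have e1 : A + t * x = A * (1 + t / A * x) := by field_simp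
    rw [e1, Real.mul_rpow hA.le (by positivity), Real.mul_rpow hs.le hx.le,
      Real.div_rpow ht.le hA.le, show -(p + q) = -q + -p by ring, Real.rpow_add hA,
      Real.rpow_sub_one ht.ne', Real.rpow_sub_one hA.ne', Real.rpow_neg ht.le, Real.rpow_neg hA.le p]
    field_simp
  rw [integrableOn_congr_fun hcongr measurableSet_Ioi,
    setIntegral_congr_fun measurableSet_Ioi hcongr, integral_const_mul]
  have h1 := integral_comp_mul_left_Ioi
    (fun y : ℝ => y ^ (p - 1) * (1 + y) ^ (-(p + q))) 0 hs
  have h2 := (integrableOn_Ioi_comp_mul_left_iff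
    (fun y : ℝ => y ^ (p - 1) * (1 + y) ^ (-(p + q))) 0 hs)
  rw [mul_zero] at h1 h2
  refine ⟨(h2.mpr h.1).const_mul _, ?_⟩
  rw [h1, h.2, smul_eq_mul]
  field_simp

/-- Euler's integral `∫₀¹ t^(b-1) (1 - t)^(a-1) (1 - t + t x)⁻ᵃ dt` at the point `1 - x`. -/
def eulerReal (a b x : ℝ) : ℝ :=
  ∫ t in Set.Ioo (0 : ℝ) 1, t ^ (b - 1) * (1 - t) ^ (a - 1) * (1 - t + t * x) ^ (-a)

open MeasureTheory Set in
theorem eulerIntegral_one_sub {a b x : ℝ} (hx : 0 < x) :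
    eulerIntegral a b a (1 - x) = eulerReal a b x := by
  rw [eulerReal, ← integral_complex_ofReal, eulerIntegral]
  refine setIntegral_congr_fun measurableSet_Ioo fun t ht => ?_
  have h1 : 0 < 1 - t + t * x := by nlinarith [ht.1, ht.2, mul_pos ht.1 hx]
  have h2 : (1 : ℂ) - t * (1 - x) = ((1 - t + t * x : ℝ) : ℂ) := by push_cast; ring
  simp only [h2]
  rw [← Complex.ofReal_neg, ← Complex.ofReal_cpow h1.le, ← Complex.ofReal_mul]

open MeasureTheory Set in
-- The integrand is nonnegative, so the order of integration may be exchanged. The x-integral is a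
-- scaled beta integral, leaving t^(b-ε-1) (1-t)^(ε-1), again a beta integrand.
theorem integrableOn_mellin_eulerReal_and_integral {a b ε : ℝ} (hε : 0 < ε) (hεa : ε < a)
    (hεb : ε < b) :
    IntegrableOn (fun x => x ^ (ε - 1) * eulerReal a b x) (Ioi 0) ∧
      ∫ x in Ioi (0 : ℝ), x ^ (ε - 1) * eulerReal a b x =
        eulerBeta ε (a - ε) * eulerBeta (b - ε) ε := by
  set F : ℝ × ℝ → ℝ := fun y => (y.1 ^ (b - 1) * (1 - y.1) ^ (a - 1)) *
    (y.2 ^ (ε - 1) * (1 - y.1 + y.1 * y.2) ^ (-a)) with hF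
  have Fm : Measurable F := by fun_prop
  have h1 : ∀ t ∈ Ioo (0 : ℝ) 1, IntegrableOn (fun x => F (t, x)) (Ioi 0) ∧
      ∫ x in Ioi (0 : ℝ), F (t, x) =
        t ^ (b - ε - 1) * (1 - t) ^ (ε - 1) * eulerBeta ε (a - ε) := fun t ht => by
    have h1t : 0 < 1 - t := by linarith [ht.2]
    have h := integrableOn_beta_Ioi_scaled_and_integral hε (sub_pos.mpr hεa) h1t ht.1
    rw [show -(ε + (a - ε)) = -a by ring] at h
    refine ⟨h.1.const_mul (t ^ (b - 1) * (1 - t) ^ (a - 1)), ?_⟩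
    simp only [hF]
    rw [integral_const_mul, h.2, show b - ε - 1 = (b - 1) + -ε by ring,
      show ε - 1 = (a - 1) + -(a - ε) by ring, Real.rpow_add ht.1, Real.rpow_add h1t]
    ring
  have hpos : ∀ t ∈ Ioo (0 : ℝ) 1, ∀ x ∈ Ioi (0 : ℝ), ‖F (t, x)‖ = F (t, x) :=
    fun t ht x (hx : 0 < x) => by
      have h1t : 0 < 1 - t := by linarith [ht.2]
      have ht0 := ht.1
      refine Real.norm_of_nonneg ?_
      simp only [hF]
      positivity
  have hB := integrableOn_beta_and_integral (sub_pos.mpr hεb) hε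
  have hInt : Integrable F ((volume.restrict (Ioo 0 1)).prod (volume.restrict (Ioi 0))) := by
    rw [integrable_prod_iff Fm.aestronglyMeasurable]
    constructor
    · filter_upwards [ae_restrict_mem measurableSet_Ioo] with t ht using (h1 t ht).1
    · refine (integrableOn_congr_fun (fun t ht => ?_) measurableSet_Ioo).mpr
        (hB.1.mul_const (eulerBeta ε (a - ε)))
      rw [setIntegral_congr_fun measurableSet_Ioi (hpos t ht), (h1 t ht).2]
  have hJ : ∀ x, ∫ t in Ioo (0 : ℝ) 1, F (t, x) = x ^ (ε - 1) * eulerReal a b x := fun x => by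
    rw [eulerReal, ← integral_const_mul]
    refine integral_congr_ae (ae_of_all _ fun t => ?_)
    simp only [hF]
    ring
  have h2 := hInt.integral_prod_right
  have h3 := integral_integral_swap (f := fun t x => F (t, x)) hInt
  simp only [hJ] at h2 h3
  refine ⟨h2, ?_⟩
  rw [← h3, setIntegral_congr_fun measurableSet_Ioo fun t ht => (h1 t ht).2, integral_mul_const,
    hB.2, mul_comm]
  rfl

open MeasureTheory Set in
-- An elementary comparison function whose behaviour at 0 is -log x with no constant term.
theorem eulerReal_one_one {x : ℝ} (hx : 0 < x) (hx1 : x < 1) :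
    eulerReal 1 1 x = Real.log x / (x - 1) := by
  have hne : x - 1 ≠ 0 := by linarith
  have hpos : ∀ t ∈ Icc (0 : ℝ) 1, 0 < 1 - t + t * x := fun t ht => by
    nlinarith [ht.1, ht.2, mul_nonneg ht.1 hx.le]
  have h1 : ∀ t ∈ uIcc (0 : ℝ) 1, HasDerivAt (fun t => Real.log (1 - t + t * x) / (x - 1))
      ((1 - t + t * x)⁻¹) t := fun t ht => by
    rw [uIcc_of_le zero_le_one] at ht
    have h2 : HasDerivAt (fun t : ℝ => 1 - t + t * x) (x - 1) t := by
      have := ((hasDerivAt_id t).const_sub 1).add ((hasDerivAt_id t).mul_const x)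
      refine this.congr_deriv ?_
      ring
    refine ((h2.log (hpos t ht).ne').div_const (x - 1)).congr_deriv ?_
    field_simp
  have h2 := intervalIntegral.integral_eq_sub_of_hasDerivAt h1
    (ContinuousOn.intervalIntegrable (ContinuousOn.inv₀ (by fun_prop) fun t ht => by
      rw [uIcc_of_le zero_le_one] at ht
      exact (hpos t ht).ne'))
  rw [intervalIntegral.integral_of_le zero_le_one, integral_Ioc_eq_integral_Ioo] at h2
  rw [eulerReal]
  simp only [sub_self, Real.rpow_zero, one_mul, Real.rpow_neg_one]
  rw [h2]
  simp

open MeasureTheory Set in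
/-- An Abelian theorem for the Mellin transform at its first pole. -/
theorem tendsto_mul_mellin {ρ : ℝ → ℂ} {k : ℂ} (hρ : Tendsto ρ (𝓝[>] 0) (𝓝 k)) {ε₀ : ℝ}
    (hε₀ : 0 < ε₀)
    (hint : ∀ ε ∈ Ioc 0 ε₀, IntegrableOn (fun x : ℝ => ((x ^ (ε - 1) : ℝ) : ℂ) * ρ x) (Ioi 0)) :
    Tendsto (fun ε : ℝ => (ε : ℂ) * ∫ x in Ioi (0 : ℝ), ((x ^ (ε - 1) : ℝ) : ℂ) * ρ x)
      (𝓝[>] 0) (𝓝 k) := by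
  rw [Metric.tendsto_nhds]
  intro η hη
  obtain ⟨δ', hδ', hδρ⟩ := mem_nhdsGT_iff_exists_Ioc_subset.mp
    (hρ (Metric.closedBall_mem_nhds k (show 0 < η / 4 by positivity)))
  set δ := min δ' 1 with hδdef
  have hδ : 0 < δ := lt_min hδ' one_pos
  have hδ1 : δ ≤ 1 := min_le_right _ _
  have hclose : ∀ x ∈ Ioc 0 δ, ‖ρ x - k‖ ≤ η / 4 := fun x hx => by
    have := hδρ ⟨hx.1, hx.2.trans (min_le_left _ _)⟩
    rwa [mem_preimage, Metric.mem_closedBall, dist_eq_norm] at this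
  -- A bound for the tail uniform in ε: x^(ε-ε₀) ≤ δ^(-ε₀) for x > δ, using δ ≤ 1. The factor ε then
  -- makes the tail vanish.
  set C : ℝ := ∫ x in Ioi δ, δ ^ (-ε₀) * ‖((x ^ (ε₀ - 1) : ℝ) : ℂ) * ρ x‖ with hC
  have l1 : Tendsto (fun ε : ℝ => ε * C) (𝓝[>] 0) (𝓝 0) := by
    have : Continuous fun ε : ℝ => ε * C := by fun_prop
    exact (this.tendsto' _ _ (zero_mul C)).mono_left nhdsWithin_le_nhds
  have l2 : Tendsto (fun ε : ℝ => ‖k‖ * |δ ^ ε - 1|) (𝓝[>] 0) (𝓝 0) := by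
    have : Continuous fun ε : ℝ => ‖k‖ * |δ ^ ε - 1| :=
      continuous_const.mul (((Real.continuous_const_rpow hδ.ne').sub continuous_const).abs)
    exact (this.tendsto' _ _ (by simp)).mono_left nhdsWithin_le_nhds
  filter_upwards [Ioc_mem_nhdsGT hε₀, l1.eventually_lt_const (show 0 < η / 4 by positivity),
    l2.eventually_lt_const (show 0 < η / 4 by positivity)] with ε hε h1 h2
  have hI := hint ε hε
  have hI1 := hI.mono_set (Ioc_subset_Ioi_self : Ioc 0 δ ⊆ Ioi 0)
  have hI2 := hI.mono_set (Ioi_subset_Ioi hδ.le)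
  have hpow : IntegrableOn (fun x : ℝ => x ^ (ε - 1)) (Ioc 0 δ) ∧
      ∫ x in Ioc (0 : ℝ) δ, x ^ (ε - 1) = δ ^ ε / ε := by
    constructor
    · exact (intervalIntegral.intervalIntegrable_rpow' (by linarith [hε.1])).1
    · rw [← intervalIntegral.integral_of_le hδ.le, integral_rpow (Or.inl (by linarith [hε.1])),
        sub_add_cancel, Real.zero_rpow hε.1.ne', sub_zero]
  have hpowk : IntegrableOn (fun x : ℝ => ((x ^ (ε - 1) : ℝ) : ℂ) * k) (Ioc 0 δ) :=
    hpow.1.ofReal.mul_const k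
  -- Splitting off the limit k isolates the pole: ε ∫₀^δ x^(ε-1) dx = δ^ε → 1.
  have e1 : ∫ x in Ioc (0 : ℝ) δ, ((x ^ (ε - 1) : ℝ) : ℂ) * ρ x =
      (∫ x in Ioc (0 : ℝ) δ, ((x ^ (ε - 1) : ℝ) : ℂ) * (ρ x - k)) + ((δ ^ ε / ε : ℝ) : ℂ) * k := by
    rw [← hpow.2, ← integral_complex_ofReal, ← integral_mul_const, ← integral_add ?_ hpowk]
    · refine integral_congr_ae (ae_of_all _ fun x => ?_)
      ring
    · refine (hI1.sub hpowk).congr (ae_of_all _ fun x => ?_)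
      simp only [Pi.sub_apply]
      ring
  have b1 : ‖∫ x in Ioc (0 : ℝ) δ, ((x ^ (ε - 1) : ℝ) : ℂ) * (ρ x - k)‖ ≤ δ ^ ε / ε * (η / 4) := by
    rw [← hpow.2, ← integral_mul_const]
    refine norm_integral_le_of_norm_le (hpow.1.mul_const _) ?_
    filter_upwards [ae_restrict_mem measurableSet_Ioc] with x hx
    have h3 : 0 ≤ x ^ (ε - 1) := Real.rpow_nonneg hx.1.le _
    rw [norm_mul, Complex.norm_real, Real.norm_of_nonneg h3]
    exact mul_le_mul_of_nonneg_left (hclose x hx) h3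
  have b2 : ‖∫ x in Ioi δ, ((x ^ (ε - 1) : ℝ) : ℂ) * ρ x‖ ≤ C := by
    refine norm_integral_le_of_norm_le
      (((hint ε₀ ⟨hε₀, le_rfl⟩).mono_set (Ioi_subset_Ioi hδ.le)).norm.const_mul _) ?_
    filter_upwards [ae_restrict_mem measurableSet_Ioi] with x (hx : δ < x)
    have hx0 : 0 < x := hδ.trans hx
    rw [norm_mul, norm_mul, Complex.norm_real, Complex.norm_real,
      Real.norm_of_nonneg (Real.rpow_nonneg hx0.le _),
      Real.norm_of_nonneg (Real.rpow_nonneg hx0.le _), ← mul_assoc]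
    refine mul_le_mul_of_nonneg_right ?_ (norm_nonneg _)
    rw [show ε - 1 = (ε - ε₀) + (ε₀ - 1) by ring, Real.rpow_add hx0]
    refine mul_le_mul_of_nonneg_right ?_ (Real.rpow_nonneg hx0.le _)
    calc x ^ (ε - ε₀) ≤ δ ^ (ε - ε₀) :=
          Real.rpow_le_rpow_of_nonpos hδ hx.le (by linarith [hε.2])
      _ ≤ δ ^ (-ε₀) := Real.rpow_le_rpow_of_exponent_ge hδ hδ1 (by linarith [hε.1])
  have hε0 : (ε : ℂ) ≠ 0 := by exact_mod_cast hε.1.ne'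
  have e2 : (ε : ℂ) * (∫ x in Ioi (0 : ℝ), ((x ^ (ε - 1) : ℝ) : ℂ) * ρ x) - k =
      ε * (∫ x in Ioc (0 : ℝ) δ, ((x ^ (ε - 1) : ℝ) : ℂ) * (ρ x - k)) +
        k * ((δ ^ ε - 1 : ℝ) : ℂ) + ε * ∫ x in Ioi δ, ((x ^ (ε - 1) : ℝ) : ℂ) * ρ x := by
    rw [← Ioc_union_Ioi_eq_Ioi hδ.le, setIntegral_union (Ioc_disjoint_Ioi le_rfl)
      measurableSet_Ioi hI1 hI2, e1]
    push_cast
    field_simp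
    ring
  rw [dist_eq_norm, e2]
  have hδε : δ ^ ε ≤ 1 := Real.rpow_le_one hδ.le hδ1 hε.1.le
  have n1 : ‖(ε : ℂ) * ∫ x in Ioc (0 : ℝ) δ, ((x ^ (ε - 1) : ℝ) : ℂ) * (ρ x - k)‖ ≤ η / 4 := by
    rw [norm_mul, Complex.norm_real, Real.norm_of_nonneg hε.1.le]
    calc _ ≤ ε * (δ ^ ε / ε * (η / 4)) := mul_le_mul_of_nonneg_left b1 hε.1.le
      _ = δ ^ ε * (η / 4) := by field_simp [hε.1.ne']
      _ ≤ 1 * (η / 4) := by gcongr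
      _ = η / 4 := one_mul _
  have n2 : ‖k * ((δ ^ ε - 1 : ℝ) : ℂ)‖ < η / 4 := by
    rwa [norm_mul, Complex.norm_real, Real.norm_eq_abs]
  have n3 : ‖(ε : ℂ) * ∫ x in Ioi δ, ((x ^ (ε - 1) : ℝ) : ℂ) * ρ x‖ < η / 4 := by
    rw [norm_mul, Complex.norm_real, Real.norm_of_nonneg hε.1.le]
    exact (mul_le_mul_of_nonneg_left b2 hε.1.le).trans_lt h1
  calc _ ≤ _ := norm_add₃_le
    _ < η := by linarith

/-! ### The constants in the connection formula -/

theorem eulerBeta_comm (p q : ℝ) : eulerBeta p q = eulerBeta q p := by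
  rw [eulerBeta, eulerBeta, mul_comm, add_comm]

theorem eulerReal_eq_mul_gaussF {a b x : ℝ} (ha : 0 < a) (hb : 0 < b) (hx : 0 < x) (hx1 : x < 1) :
    (eulerReal a b x : ℂ) = eulerBeta a b * gaussF a b (a + b) (1 - x) := by
  have h1 : ‖(1 - x : ℂ)‖ < 1 := by
    rw [← Complex.ofReal_one, ← Complex.ofReal_sub, Complex.norm_real, Real.norm_eq_abs, abs_lt]
    constructor <;> linarith
  have h2 := (gaussF_spec (c := a + b) ha hb (by linarith)).2 _ h1
  rw [← eulerIntegral_one_sub hx, eulerIntegral_eq_mul_ordinaryHypergeometric ha hb ha h1,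
    eulerBeta_comm, add_comm b a, ← h2, Complex.ofReal_add]

/-- The quotient `Γ(a - ε) Γ(b - ε) / (Γ(a) Γ(b))`. -/
def gammaShift (a b ε : ℝ) : ℝ :=
  Real.Gamma (a - ε) * Real.Gamma (b - ε) / (Real.Gamma a * Real.Gamma b)

theorem gammaShift_zero {a b : ℝ} (ha : 0 < a) (hb : 0 < b) : gammaShift a b 0 = 1 := by
  rw [gammaShift, sub_zero, sub_zero, div_self]
  exact mul_ne_zero (Real.Gamma_pos_of_pos ha).ne' (Real.Gamma_pos_of_pos hb).ne'

theorem hasDerivAt_gammaShift {a b : ℝ} (ha : 0 < a) (hb : 0 < b) :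
    HasDerivAt (gammaShift a b) (-realDigamma a - realDigamma b) 0 := by
  have d1 : HasDerivAt (fun ε : ℝ => Real.Gamma (a - ε)) _ 0 :=
    HasDerivAt.comp_const_sub a 0 (hasDerivAt_Gamma_of_pos (by simpa using ha))
  have d2 : HasDerivAt (fun ε : ℝ => Real.Gamma (b - ε)) _ 0 :=
    HasDerivAt.comp_const_sub b 0 (hasDerivAt_Gamma_of_pos (by simpa using hb))
  refine ((d1.mul d2).div_const _).congr_deriv ?_
  have g1 := (Real.Gamma_pos_of_pos ha).ne'
  have g2 := (Real.Gamma_pos_of_pos hb).ne'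
  simp only [sub_zero]
  field_simp
  ring

/-- The product of beta values contains Γ(ε)², a double pole at 0; here ε Γ(ε)² = Γ(ε+1)² / ε. -/
theorem mul_eulerBeta_mul_eulerBeta {a b ε : ℝ} (hε : 0 < ε) :
    ε * (eulerBeta ε (a - ε) * eulerBeta (b - ε) ε) =
      Real.Gamma (ε + 1) ^ 2 * (gammaShift a b ε / ε) := by
  rw [Real.Gamma_add_one hε.ne', eulerBeta, eulerBeta, gammaShift, add_sub_cancel, sub_add_cancel]
  field_simp

open MeasureTheory Set in
/-- Comparison of `eulerReal a b` with `eulerReal 1 1` near the origin determines the logarithmic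
coefficient and the constant term. -/
theorem eulerReal_expansion_constants {a b : ℝ} (ha : 0 < a) (ha1 : a ≤ 1) (hb : 0 < b)
    (hb1 : b ≤ 1) {κ k : ℂ}
    (h : Tendsto (fun x => (eulerReal a b x : ℂ) - κ * eulerReal 1 1 x) (𝓝[>] 0) (𝓝 k)) :
    κ = 1 ∧ k = ((2 * realDigamma 1 - realDigamma a - realDigamma b : ℝ) : ℂ) := by
  set ε₀ := min a b / 2 with hε₀def
  have hab : 0 < min a b := lt_min ha hb
  have hε₀ : 0 < ε₀ := by positivity
  have hεa : ∀ ε ∈ Ioc 0 ε₀, ε < a := fun ε hε => by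
    linarith [hε.2, min_le_left a b]
  have hεb : ∀ ε ∈ Ioc 0 ε₀, ε < b := fun ε hε => by
    linarith [hε.2, min_le_right a b]
  have hM : ∀ ε ∈ Ioc 0 ε₀,
      IntegrableOn (fun x : ℝ => ((x ^ (ε - 1) : ℝ) : ℂ) *
        ((eulerReal a b x : ℂ) - κ * eulerReal 1 1 x)) (Ioi 0) ∧
      ∫ x in Ioi (0 : ℝ), ((x ^ (ε - 1) : ℝ) : ℂ) *
        ((eulerReal a b x : ℂ) - κ * eulerReal 1 1 x) =
          ((eulerBeta ε (a - ε) * eulerBeta (b - ε) ε : ℝ) : ℂ) -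
            κ * ((eulerBeta ε (1 - ε) * eulerBeta (1 - ε) ε : ℝ) : ℂ) := fun ε hε => by
    have m1 := integrableOn_mellin_eulerReal_and_integral hε.1 (hεa ε hε) (hεb ε hε)
    have m2 := integrableOn_mellin_eulerReal_and_integral (a := 1) (b := 1) hε.1
      (by linarith [hεa ε hε]) (by linarith [hεb ε hε])
    have i1 : IntegrableOn (fun x : ℝ => ((x ^ (ε - 1) * eulerReal a b x : ℝ) : ℂ)) (Ioi 0) :=
      m1.1.ofReal
    have i2 : IntegrableOn (fun x : ℝ => κ * ((x ^ (ε - 1) * eulerReal 1 1 x : ℝ) : ℂ)) (Ioi 0) :=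
      m2.1.ofReal.const_mul κ
    have e : (fun x : ℝ => ((x ^ (ε - 1) : ℝ) : ℂ) *
        ((eulerReal a b x : ℂ) - κ * eulerReal 1 1 x)) = fun x =>
        ((x ^ (ε - 1) * eulerReal a b x : ℝ) : ℂ) -
          κ * ((x ^ (ε - 1) * eulerReal 1 1 x : ℝ) : ℂ) := by
      funext x; push_cast; ring
    rw [e]
    refine ⟨i1.sub i2, ?_⟩
    rw [integral_sub i1 i2, integral_const_mul, integral_complex_ofReal, integral_complex_ofReal,
      m1.2, m2.2]
  have hlim := tendsto_mul_mellin h hε₀ fun ε hε => (hM ε hε).1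
  -- ε times the Mellin transform of the difference is Γ(ε+1)² g(ε)/ε, and it tends to k. Finiteness
  -- forces g(0) = 1 - κ = 0, and then k = g'(0).
  set g : ℝ → ℂ := fun ε => (gammaShift a b ε : ℂ) - κ * gammaShift 1 1 ε with hg
  have hg' : HasDerivAt g (((-realDigamma a - realDigamma b : ℝ) : ℂ) -
      κ * ((-realDigamma 1 - realDigamma 1 : ℝ) : ℂ)) 0 :=
    (hasDerivAt_gammaShift ha hb).ofReal_comp.sub
      ((hasDerivAt_gammaShift one_pos one_pos).ofReal_comp.const_mul κ)
  have g0 : g 0 = 1 - κ := by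
    simp [hg, gammaShift_zero ha hb, gammaShift_zero one_pos one_pos]
  have hΓ : Tendsto (fun ε : ℝ => ((Real.Gamma (ε + 1) ^ 2 : ℝ) : ℂ)) (𝓝[>] 0) (𝓝 1) := by
    have h1 : ContinuousAt (fun ε : ℝ => Real.Gamma (ε + 1) ^ 2) 0 :=
      ((differentiableAt_Gamma_of_pos (x := 0 + 1) (by norm_num)).continuousAt.comp
        (f := fun ε : ℝ => ε + 1) (by fun_prop)).pow 2
    have h2 := (Complex.continuous_ofReal.continuousAt.comp h1).tendsto
    simp only [Function.comp_apply, zero_add, Real.Gamma_one, one_pow, Complex.ofReal_one] at h2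
    exact h2.mono_left nhdsWithin_le_nhds
  have hgk : Tendsto (fun ε : ℝ => g ε / ε) (𝓝[>] 0) (𝓝 k) := by
    have h1 := hlim.div hΓ one_ne_zero
    rw [div_one] at h1
    refine h1.congr' ?_
    filter_upwards [Ioc_mem_nhdsGT hε₀] with ε hε
    have hne : ((Real.Gamma (ε + 1) ^ 2 : ℝ) : ℂ) ≠ 0 := by
      exact_mod_cast (pow_pos (Real.Gamma_pos_of_pos (by linarith [hε.1])) 2).ne'
    have e1 := congrArg (fun x : ℝ => (x : ℂ))
      (mul_eulerBeta_mul_eulerBeta (a := a) (b := b) hε.1)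
    have e2 := congrArg (fun x : ℝ => (x : ℂ))
      (mul_eulerBeta_mul_eulerBeta (a := 1) (b := 1) hε.1)
    simp only [Complex.ofReal_mul ε, Complex.ofReal_mul (Real.Gamma (ε + 1) ^ 2),
      Complex.ofReal_div] at e1 e2
    rw [Pi.div_apply, (hM ε hε).2, div_eq_iff hne]
    simp only [hg]
    linear_combination e1 - κ * e2
  have hg0 : Tendsto g (𝓝[>] 0) (𝓝 0) := by
    have h1 : Tendsto (fun ε : ℝ => (ε : ℂ)) (𝓝[>] 0) (𝓝 0) :=
      (Complex.continuous_ofReal.tendsto' 0 0 (by simp)).mono_left nhdsWithin_le_nhds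
    have h2 := hgk.mul h1
    rw [mul_zero] at h2
    refine h2.congr' ?_
    filter_upwards [self_mem_nhdsWithin] with ε (hε : 0 < ε)
    have : (ε : ℂ) ≠ 0 := by exact_mod_cast hε.ne'
    field_simp
  have hκ : κ = 1 := by
    have := tendsto_nhds_unique hg0 (hg'.continuousAt.tendsto.mono_left nhdsWithin_le_nhds)
    rw [g0] at this
    exact (sub_eq_zero.mp this.symm).symm
  refine ⟨hκ, ?_⟩
  have h1 := (hasDerivAt_iff_tendsto_slope_zero.mp hg').mono_left
    (nhdsWithin_mono 0 fun x (hx : 0 < x) => hx.ne' : 𝓝[>] (0 : ℝ) ≤ 𝓝[≠] 0)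
  rw [g0, hκ, sub_self] at h1
  have h2 := tendsto_nhds_unique hgk (h1.congr fun ε => by
    rw [zero_add, sub_zero, Complex.real_smul, Complex.ofReal_inv, div_eq_inv_mul])
  rw [h2]
  push_cast
  ring

/-- The connection formula at the cusp. -/
theorem exists_connection_formula {a b : ℝ} (ha : 0 < a) (ha1 : a ≤ 1) (hb : 0 < b) (hb1 : b < 1) :
    ∃ r : ℝ, 0 < r ∧ r ≤ 1 ∧ ∃ Q : ℂ → ℂ, DifferentiableOn ℂ Q (Metric.ball 0 r) ∧
      Q 0 = ((2 * realDigamma 1 - realDigamma a - realDigamma b : ℝ) : ℂ) ∧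
      (∀ z ∈ Metric.ball (0 : ℂ) r, gaussF a b 1 z ≠ 0) ∧
      ∀ z ∈ Metric.ball (0 : ℂ) r ∩ Complex.slitPlane,
        eulerBeta a b * gaussF a b (a + b) (1 - z) =
          gaussF a b 1 z * (-Complex.log z + Q z) := by
  obtain ⟨r, hr, hr1, K, Q, hQ, hf, hexp⟩ := exists_log_expansion ha hb hb1
  obtain ⟨f_an, f_eq⟩ := gaussF_spec ha hb hb1
  rw [Complex.ofReal_one] at f_an f_eq
  have f0 : gaussF a b 1 0 = 1 := by rw [f_eq 0 (by simp), ordinaryHypergeometric_zero]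
  have fd : DifferentiableAt ℂ (gaussF a b 1) 0 :=
    (f_an 0 (mem_cutPlane_of_norm_lt_one (by simp))).differentiableAt
  set B : ℂ := (eulerBeta a b : ℂ) with hB
  have hx0 : Tendsto (fun x : ℝ => (x : ℂ)) (𝓝[>] 0) (𝓝 0) :=
    (Complex.continuous_ofReal.tendsto' 0 0 (by simp)).mono_left nhdsWithin_le_nhds
  -- At x = 0, φ₁ is 1 and 1/(x-1) is -1, so their sum is x times a convergent slope. Multiplied by
  -- log x it tends to 0, since x log x does.
  have hm : HasDerivAt (fun z : ℂ => gaussF a b 1 z + (z - 1)⁻¹)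
      (deriv (gaussF a b 1) 0 + -1 / ((0 : ℂ) - 1) ^ 2) ((0 : ℝ) : ℂ) := by
    rw [Complex.ofReal_zero]
    exact fd.hasDerivAt.add (((hasDerivAt_id (0 : ℂ)).sub_const 1).inv (by simp))
  have h1 := (hasDerivAt_iff_tendsto_slope_zero.mp hm.comp_ofReal).mono_left
    (nhdsWithin_mono 0 fun x (hx : 0 < x) => hx.ne' : 𝓝[>] (0 : ℝ) ≤ 𝓝[≠] 0)
  have h2 : Tendsto (fun x : ℝ => ((x * Real.log x : ℝ) : ℂ)) (𝓝[>] 0) (𝓝 0) :=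
    ((Complex.continuous_ofReal.comp Real.continuous_mul_log).tendsto' 0 0 (by simp)).mono_left
      nhdsWithin_le_nhds
  have h3 : Tendsto (fun x : ℝ => B * (gaussF a b 1 x * Q x)) (𝓝[>] 0) (𝓝 (B * (1 * Q 0))) := by
    have hQ0 : ContinuousAt Q 0 :=
      ((hQ 0 (Metric.mem_ball_self hr)).differentiableAt (Metric.ball_mem_nhds 0 hr)).continuousAt
    have := fd.continuousAt.tendsto.comp hx0
    rw [f0] at this
    exact (this.mul (hQ0.tendsto.comp hx0)).const_mul B
  have h4 := ((h2.mul h1).const_mul (K * B)).add h3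
  rw [zero_mul, mul_zero, zero_add, one_mul] at h4
  -- With κ = -KB the difference is KB log x (φ₁ + 1/(x-1)) + B φ₁ Q, whose limit is B Q(0).
  have key := eulerReal_expansion_constants ha ha1 hb hb1.le (κ := -(K * B)) (h4.congr' (by
    filter_upwards [Ioo_mem_nhdsGT hr] with x hx
    have hx1 : x < 1 := hx.2.trans_le hr1
    have hxr : (x : ℂ) ∈ Metric.ball (0 : ℂ) r ∩ Complex.slitPlane := by
      refine ⟨?_, Complex.ofReal_mem_slitPlane.mpr hx.1⟩
      rw [mem_ball_zero_iff, Complex.norm_real, Real.norm_of_nonneg hx.1.le]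
      exact hx.2
    rw [eulerReal_eq_mul_gaussF ha hb hx.1 hx1, eulerReal_one_one hx.1 hx1, hexp _ hxr,
      ← Complex.ofReal_log hx.1.le]
    have hx0' : (x : ℂ) ≠ 0 := by exact_mod_cast hx.1.ne'
    have hx1' : (x : ℂ) - 1 ≠ 0 := by
      have : x - 1 ≠ 0 := by linarith
      exact_mod_cast this
    simp only [zero_add, Complex.real_smul, Complex.ofReal_zero, f0]
    push_cast
    field_simp
    ring))
  refine ⟨r, hr, hr1, fun z => B * Q z, hQ.const_mul B, key.2, hf, fun z hz => ?_⟩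
  rw [hexp z hz]
  linear_combination (-gaussF a b 1 z * Complex.log z) * key.1

/-! ### The density near the cusp -/

/-- The function `H(z) = 2 Re Q(z̄) - S`. -/
def cuspH (a b : ℝ) (Q : ℂ → ℂ) (z : ℂ) : ℝ :=
  2 * (Q (starRingEnd ℂ z)).re -
    Real.pi * Real.sin (Real.pi * (a + b)) / (Real.sin (Real.pi * a) * Real.sin (Real.pi * b))

theorem conj_mem_slitPlane {z : ℂ} (hz : z ∈ Complex.slitPlane) :
    starRingEnd ℂ z ∈ Complex.slitPlane := by
  simpa [Complex.mem_slitPlane_iff] using hz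

/-- Use the connection formula at z̄. Real coefficients give φ₁(z̄) as the conjugate of φ₁(z), so
φ₁(z) φ₂(z̄) acquires the factor |φ₁|², and the real part of -log z̄ is log (1/|z|). The term with
`cuspK₁` contributes -S. -/
theorem exists_cuspM_eq {a b : ℝ} (ha : 0 < a) (ha1 : a ≤ 1) (hb : 0 < b) (hb1 : b < 1) :
    ∃ r : ℝ, 0 < r ∧ r ≤ 1 ∧ ∃ Q : ℂ → ℂ, DifferentiableOn ℂ Q (Metric.ball 0 r) ∧
      Q 0 = ((2 * realDigamma 1 - realDigamma a - realDigamma b : ℝ) : ℂ) ∧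
      (∀ z ∈ Metric.ball (0 : ℂ) r, gaussF a b 1 z ≠ 0) ∧
      ∀ z ∈ Metric.ball (0 : ℂ) r ∩ Complex.slitPlane,
        eulerBeta a b * cuspM a b z =
          ‖gaussF a b 1 z‖ ^ 2 * (2 * Real.log (1 / ‖z‖) + cuspH a b Q z) := by
  obtain ⟨r, hr, hr1, Q, hQ, hQ0, hf, hconn⟩ := exists_connection_formula ha ha1 hb hb1
  refine ⟨r, hr, hr1, Q, hQ, hQ0, hf, fun z hz => ?_⟩
  have hB := (eulerBeta_pos ha hb).ne'
  have hzn : ‖z‖ < 1 := (mem_ball_zero_iff.mp hz.1).trans_le hr1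
  have hc := hconn (starRingEnd ℂ z)
    ⟨by rw [mem_ball_zero_iff, RCLike.norm_conj]; exact mem_ball_zero_iff.mp hz.1,
      conj_mem_slitPlane hz.2⟩
  have hconj : gaussF a b 1 (starRingEnd ℂ z) = starRingEnd ℂ (gaussF a b 1 z) := by
    have h := (gaussF_spec ha hb hb1).2
    rw [Complex.ofReal_one] at h
    rw [h z hzn, h _ (by rwa [RCLike.norm_conj])]
    simpa using ordinaryHypergeometric_conj ha hb one_pos hzn
  have hre : eulerBeta a b *
      (gaussF a b 1 z * gaussF a b (a + b) (1 - starRingEnd ℂ z)).re =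
      ‖gaussF a b 1 z‖ ^ 2 * (Real.log (1 / ‖z‖) + (Q (starRingEnd ℂ z)).re) := by
    rw [← Complex.re_ofReal_mul, mul_left_comm, hc, hconj, ← mul_assoc, Complex.mul_conj',
      ← Complex.ofReal_pow, Complex.re_ofReal_mul, Complex.add_re, Complex.neg_re, Complex.log_re,
      RCLike.norm_conj, one_div, Real.log_inv]
  rw [cuspM, mul_add, mul_left_comm _ (2 : ℝ), hre, cuspK₁, cuspH]
  field_simp
  ring

/-- Points off the real axis avoid both cuts, so real points are reached vertically. This makes the
extension by limits meaningful. -/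
theorem mem_closure_two_cuts {z : ℂ} (hz1 : ‖z‖ < 1) :
    z ∈ closure {z : ℂ | z ∈ Complex.slitPlane ∧ 1 - z ∈ Complex.slitPlane} := by
  by_cases him : z.im = 0
  · have h : Tendsto (fun t : ℝ => z + t * Complex.I) (𝓝[>] 0) (𝓝 z) :=
      (Continuous.tendsto' (by fun_prop) _ _ (by simp)).mono_left nhdsWithin_le_nhds
    refine mem_closure_of_tendsto h ?_
    filter_upwards [self_mem_nhdsWithin] with t (ht : 0 < t)
    simp [Complex.mem_slitPlane_iff, him, ht.ne']
  · exact subset_closure ⟨Complex.mem_slitPlane_iff.mpr (Or.inr him),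
      mem_cutPlane_of_norm_lt_one hz1⟩

theorem AnalyticAt.contDiffAt_real {f : ℂ → ℂ} {z : ℂ} (h : AnalyticAt ℂ f z) :
    ContDiffAt ℝ ∞ f z :=
  h.contDiffAt.restrict_scalars ℝ

theorem contDiffAt_cuspPoint {z : ℂ} (hz : z ≠ 0) (hz1 : Real.log (1 / ‖z‖) ≠ 0) :
    ContDiffAt ℝ ∞ cuspPoint z := by
  refine contDiffAt_id.prodMk (ContDiffAt.inv (ContDiffAt.log (ContDiffAt.div contDiffAt_const
    (contDiffAt_norm ℝ hz) ?_) ?_) hz1)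
  · exact norm_ne_zero_iff.mpr hz
  · exact one_div_ne_zero (norm_ne_zero_iff.mpr hz)

/-- Near the cusp, the remainder is a smooth function of `z` and `1 / log (1 / |z|)`. -/
theorem exists_cuspRemainder_eq {β γ : ℝ} (hβ₀ : 0 < β) (hβ₁ : β < 1) (hγ₁ : γ ≤ 1)
    (hβγ : 1 + β + γ > 2) :
    ∃ Φ : ℂ × ℝ → ℝ, (∀ᶠ p in 𝓝 0, ContDiffAt ℝ ∞ Φ p) ∧
      HasDerivAt (fun t : ℝ => Φ (0, t))
        (-(digammaG (cuspA β γ) + digammaG (cuspB β γ)) / 2) 0 ∧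
      ∀ᶠ z in 𝓝[≠] (0 : ℂ), 0 < hypDensity β γ z ∧ cuspRemainder β γ z = Φ (cuspPoint z) := by
  have ha : 0 < cuspA β γ := by unfold cuspA; linarith
  have ha1 : cuspA β γ < 1 := by unfold cuspA; linarith
  have hb : 0 < cuspB β γ := by unfold cuspB; linarith
  have hb1 : cuspB β γ < 1 := by unfold cuspB; linarith
  set a := cuspA β γ with ha_def
  set b := cuspB β γ with hb_def
  obtain ⟨r, hr, hr1, Q, hQ, hQ0, hf, hM⟩ := exists_cuspM_eq ha ha1.le hb hb1
  set f := gaussF a b 1 with hf_def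
  set H := cuspH a b Q with hH_def
  have hB := eulerBeta_pos ha hb
  have f_an : ∀ z ∈ Metric.ball (0 : ℂ) r, AnalyticAt ℂ f z := fun z hz => by
    have := (gaussF_spec ha hb hb1).1 z
      (mem_cutPlane_of_norm_lt_one ((mem_ball_zero_iff.mp hz).trans_le hr1))
    rwa [Complex.ofReal_one] at this
  have f_cd : ∀ z ∈ Metric.ball (0 : ℂ) r, ContDiffAt ℝ ∞ f z := fun z hz =>
    AnalyticAt.contDiffAt_real (f_an z hz)
  have H_cd : ∀ z ∈ Metric.ball (0 : ℂ) r, ContDiffAt ℝ ∞ H z := fun z hz => by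
    have hz' : starRingEnd ℂ z ∈ Metric.ball (0 : ℂ) r := by
      rw [mem_ball_zero_iff, RCLike.norm_conj]
      exact mem_ball_zero_iff.mp hz
    have h1 : ContDiffAt ℝ ∞ Q (starRingEnd ℂ z) :=
      AnalyticAt.contDiffAt_real (hQ.analyticAt (Metric.isOpen_ball.mem_nhds hz'))
    have h2 : ContDiffAt ℝ ∞ (fun z => Q (starRingEnd ℂ z)) z :=
      h1.comp z (Complex.conjCLE : ℂ →L[ℝ] ℂ).contDiff.contDiffAt
    exact (contDiffAt_const.mul (Complex.reCLM.contDiff.contDiffAt.comp z h2)).sub contDiffAt_const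
  have H0 : H 0 = digammaG a + digammaG b := by
    rw [digammaG_add_digammaG ha ha1 hb hb1, hH_def, cuspH, map_zero, hQ0, Complex.ofReal_re]
  have one_sub_ne : ∀ z ∈ Metric.ball (0 : ℂ) r, 1 - z ≠ 0 := fun z hz =>
    Complex.slitPlane_ne_zero
      (mem_cutPlane_of_norm_lt_one ((mem_ball_zero_iff.mp hz).trans_le hr1))
  -- Writing 2L + H = L(2 + Hτ) with L = log (1/|z|) = 1/τ, the summand log L of w cancels and only
  -- smooth terms remain.
  set Φ : ℂ × ℝ → ℝ := fun p =>
    -(β * Real.log ‖1 - p.1‖) - 2 * Real.log ‖f p.1‖ - Real.log (2 + H p.1 * p.2) with hΦ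
  have hball : Metric.ball (0 : ℂ) r ∈ 𝓝 0 := Metric.ball_mem_nhds 0 hr
  have hfst : Tendsto (fun p : ℂ × ℝ => p.1) (𝓝 0) (𝓝 0) := continuous_fst.tendsto' _ _ rfl
  have hpos : ∀ᶠ p : ℂ × ℝ in 𝓝 0, 0 < 2 + H p.1 * p.2 := by
    have h0 : ContinuousAt (fun p : ℂ × ℝ => H p.1) 0 :=
      ContinuousAt.comp (f := fun p : ℂ × ℝ => p.1) (x := (0 : ℂ × ℝ))
        (H_cd 0 (Metric.mem_ball_self hr)).continuousAt continuousAt_fst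
    have h1 : ContinuousAt (fun p : ℂ × ℝ => 2 + H p.1 * p.2) 0 :=
      continuousAt_const.add (h0.mul continuousAt_snd)
    exact h1.eventually (lt_mem_nhds (by simp))
  refine ⟨Φ, ?_, ?_, ?_⟩
  · filter_upwards [hfst.eventually hball, hpos] with p hp hp2
    have h1 : ContDiffAt ℝ ∞ (fun p : ℂ × ℝ => f p.1) p := (f_cd _ hp).comp p contDiffAt_fst
    have h2 : ContDiffAt ℝ ∞ (fun p : ℂ × ℝ => H p.1) p := (H_cd _ hp).comp p contDiffAt_fst
    exact (((contDiffAt_const.mul (((contDiffAt_const.sub contDiffAt_fst).norm ℝ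
      (one_sub_ne _ hp)).log (norm_ne_zero_iff.mpr (one_sub_ne _ hp)))).neg).sub
      (contDiffAt_const.mul ((h1.norm ℝ (hf _ hp)).log (norm_ne_zero_iff.mpr (hf _ hp))))).sub
      ((contDiffAt_const.add (h2.mul contDiffAt_snd)).log hp2.ne')
  · have h1 : HasDerivAt (fun t : ℝ => 2 + H 0 * t) (H 0) 0 := by
      simpa using ((hasDerivAt_id (0 : ℝ)).const_mul (H 0)).const_add 2
    have h2 := (h1.log (by simp)).const_sub
      (-(β * Real.log ‖1 - (0 : ℂ)‖) - 2 * Real.log ‖f 0‖)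
    refine h2.congr_deriv ?_
    rw [H0, mul_zero, add_zero]
    ring
  · filter_upwards [nhdsWithin_le_nhds hball, tendsto_cuspPoint.eventually hpos,
      eventually_log_one_div_norm_pos, self_mem_nhdsWithin] with z hz hz2 hL (hz0 : z ≠ 0)
    have hL2 : 0 < 2 * Real.log (1 / ‖z‖) + H z := by
      have e : 2 * Real.log (1 / ‖z‖) + H z =
          Real.log (1 / ‖z‖) * (2 + H z * (Real.log (1 / ‖z‖))⁻¹) := by
        field_simp
      rw [e]
      exact mul_pos hL hz2
    have nz := norm_pos_iff.mpr hz0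
    have n1 := norm_pos_iff.mpr (one_sub_ne z hz)
    have nf := norm_pos_iff.mpr (hf z hz)
    set D : ℂ → ℝ := fun z => 1 / ‖z‖ * (1 / ‖1 - z‖ ^ β) *
      (1 / (‖f z‖ ^ 2 * (2 * Real.log (1 / ‖z‖) + H z))) with hD
    have D_cont : ContinuousAt D z := by
      have c1 : ContinuousAt f z := (f_cd z hz).continuousAt
      have c2 : ContinuousAt H z := (H_cd z hz).continuousAt
      have c3 : ContinuousAt (fun z : ℂ => Real.log (1 / ‖z‖)) z :=
        (hasFDerivAt_log_one_div_norm hz0).continuousAt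
      refine ((continuousAt_const.div continuousAt_id.norm nz.ne').mul
        (continuousAt_const.div ((continuousAt_const.sub continuousAt_id).norm.rpow_const
          (Or.inl n1.ne')) (Real.rpow_pos_of_pos n1 β).ne')).mul
        (continuousAt_const.div ((c1.norm.pow 2).mul ((continuousAt_const.mul c3).add c2)) ?_)
      positivity
    -- `D` involves no branch of the logarithm, so it is continuous across the negative axis and
    -- supplies the extended values there.
    have hdens : hypDensity β γ z = D z := by
      refine extendFrom_eq (mem_closure_two_cuts ((mem_ball_zero_iff.mp hz).trans_le hr1)) ?_
      refine (D_cont.tendsto.mono_left nhdsWithin_le_nhds).congr' ?_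
      filter_upwards [nhdsWithin_le_nhds (Metric.isOpen_ball.mem_nhds hz), self_mem_nhdsWithin]
        with ζ h1 h2
      have h3 := hM ζ ⟨h1, h2.1⟩
      simp only [hD]
      rw [← h3, ← ha_def, ← hb_def, div_div (1 : ℝ) (eulerBeta a b)]
    have hDpos : 0 < D z := by
      simp only [hD]
      positivity
    refine ⟨hdens ▸ hDpos, ?_⟩
    have e : 2 * Real.log (1 / ‖z‖) + H z =
        Real.log (1 / ‖z‖) * (2 + H z * (Real.log (1 / ‖z‖))⁻¹) := by
      field_simp
    rw [cuspRemainder, hdens]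
    simp only [hD, hΦ, cuspPoint]
    have hz2' : 2 + H z * (Real.log (1 / ‖z‖))⁻¹ ≠ 0 := hz2.ne'
    have hzβ := Real.rpow_pos_of_pos n1 β
    rw [e, Real.log_mul (by positivity) (by positivity), Real.log_mul (by positivity)
      (by positivity), one_div (_ * _), one_div (_ ^ β), Real.log_inv (_ * _),
      Real.log_inv (_ ^ β), Real.log_rpow n1, Real.log_mul (by positivity) (by positivity),
      Real.log_mul hL.ne' hz2', Real.log_pow, one_div ‖z‖, Real.log_inv ‖z‖]
    push_cast
    ring

theorem SmoothNear.ofReal_comp {Φ : ℂ × ℝ → ℝ} (h : ∀ᶠ p in 𝓝 0, ContDiffAt ℝ ∞ Φ p) :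
    SmoothNear fun p => (Φ p : ℂ) := by
  filter_upwards [h] with p hp using contDiff_ofReal.contDiffAt.comp p hp

/-! ### Limits and sharpness of the estimates. -/

theorem mainTheorem1 (β γ : ℝ) (hβ₀ : 0 < β) (hβ₁ : β < 1) (hγ₀ : 0 < γ) (hγ₁ : γ ≤ 1)
    (hβγ : 1 + β + γ > 2) :
    -- near the cusp `0` the density is positive, and the remainder is smooth and bounded
    (∀ᶠ z in 𝓝[≠] (0 : ℂ), 0 < hypDensity β γ z ∧ ContDiffAt ℝ ∞ (cuspRemainder β γ) z) ∧
    (cuspRemainder β γ =O[𝓝[≠] (0 : ℂ)] fun _ => (1 : ℝ)) ∧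
    -- the limits of the pure derivatives
    (∀ n : ℕ, 1 ≤ n →
      Tendsto
        (fun z : ℂ => z ^ n * ((Real.log (1 / ‖z‖) ^ 2 : ℝ) : ℂ) *
          (wirtinger^[n] fun ζ => (cuspRemainder β γ ζ : ℂ)) z)
        (𝓝[≠] 0)
        (𝓝 (((-1 : ℝ) ^ n * ((n - 1).factorial : ℝ) / 4 *
          (digammaG (cuspA β γ) + digammaG (cuspB β γ)) : ℝ) : ℂ))) ∧
    -- the limits of the mixed derivatives
    (∀ m n : ℕ, 1 ≤ m → 1 ≤ n →
      Tendsto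
        (fun z : ℂ => z ^ n * (starRingEnd ℂ z) ^ m * ((Real.log (1 / ‖z‖) ^ 3 : ℝ) : ℂ) *
          (wirtingerBar^[m] (wirtinger^[n] fun ζ => (cuspRemainder β γ ζ : ℂ))) z)
        (𝓝[≠] 0)
        (𝓝 (((-1 : ℝ) ^ (m + n - 1) * ((n - 1).factorial : ℝ) * ((m - 1).factorial : ℝ) / 4 *
          (digammaG (cuspA β γ) + digammaG (cuspB β γ)) : ℝ) : ℂ))) ∧
    -- the limits do not vanish, so the estimates of the derivatives of `w` are sharp
    0 < digammaG (cuspA β γ) + digammaG (cuspB β γ) ∧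
    (∀ n : ℕ, 1 ≤ n →
      (wirtinger^[n] fun ζ => (cuspRemainder β γ ζ : ℂ)) =Θ[𝓝[≠] 0]
        (fun z : ℂ => (‖z‖ ^ n)⁻¹ * (Real.log (1 / ‖z‖) ^ 2)⁻¹)) ∧
    (∀ n : ℕ, 1 ≤ n →
      (wirtingerBar^[n] fun ζ => (cuspRemainder β γ ζ : ℂ)) =Θ[𝓝[≠] 0]
        (fun z : ℂ => (‖z‖ ^ n)⁻¹ * (Real.log (1 / ‖z‖) ^ 2)⁻¹)) ∧
    (∀ m n : ℕ, 1 ≤ m → 1 ≤ n →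
      (wirtingerBar^[m] (wirtinger^[n] fun ζ => (cuspRemainder β γ ζ : ℂ))) =Θ[𝓝[≠] 0]
        (fun z : ℂ => (‖z‖ ^ (m + n))⁻¹ * (Real.log (1 / ‖z‖) ^ 3)⁻¹)) := by
  have hG : 0 < digammaG (cuspA β γ) + digammaG (cuspB β γ) := by
    refine add_pos (digammaG_pos ?_ ?_) (digammaG_pos ?_ ?_) <;> simp only [cuspA, cuspB] <;>
      linarith
  obtain ⟨Φ, hΦ, hΦ', hw⟩ := exists_cuspRemainder_eq hβ₀ hβ₁ hγ₁ hβγ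
  set G := digammaG (cuspA β γ) + digammaG (cuspB β γ)
  have hΨ := SmoothNear.ofReal_comp hΦ
  have hF : (fun ζ => (cuspRemainder β γ ζ : ℂ)) =ᶠ[𝓝[≠] 0]
      fun z => (fun p => (Φ p : ℂ)) (cuspPoint z) := by
    filter_upwards [hw] with z hz
    simp only [hz.2]
  -- One factor 1/2 comes from ∂Φ/∂τ = -G/2, the other from z∂τ = τ²/2. The minus sign accounts for
  -- the extra power of -1 in the limits.
  have hc : fderiv ℝ (fun p => (Φ p : ℂ)) 0 (0, 1) / 2 = ((-G / 4 : ℝ) : ℂ) := by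
    have h1 := hasDerivAt_snd_slice (Ψ := fun p => (Φ p : ℂ)) (z := 0) (τ := 0)
      (hΨ.self_of_nhds.differentiableAt (by simp))
    have h2 := h1.unique hΦ'.ofReal_comp
    rw [← Prod.mk_zero_zero, h2]
    push_cast
    ring
  have hc0 : ∀ x : ℂ, x ≠ 0 → x * (fderiv ℝ (fun p => (Φ p : ℂ)) 0 (0, 1) / 2) ≠ 0 :=
    fun x hx => by
      rw [hc]
      refine mul_ne_zero hx ?_
      have : -G / 4 ≠ 0 := by linarith
      exact_mod_cast this
  have hfac : ∀ n : ℕ, (n.factorial : ℂ) ≠ 0 := fun n => by exact_mod_cast n.factorial_ne_zero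
  have hsgn : ∀ n : ℕ, (-1 : ℂ) ^ n ≠ 0 := fun n => pow_ne_zero n (by norm_num)
  refine ⟨?_, ?_, ?_, ?_, hG, ?_, ?_, ?_⟩
  · filter_upwards [eventually_eventually_nhdsWithin.mpr hw, tendsto_cuspPoint.eventually hΦ,
      eventually_log_one_div_norm_pos, hw, self_mem_nhdsWithin] with z h1 h2 h3 h4 (hz : z ≠ 0)
    rw [isOpen_compl_singleton.nhdsWithin_eq hz] at h1
    refine ⟨h4.1, (h2.comp z (contDiffAt_cuspPoint hz h3.ne')).congr_of_eventuallyEq ?_⟩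
    filter_upwards [h1] with ζ hζ using hζ.2
  · have h1 : Tendsto (fun z => Φ (cuspPoint z)) (𝓝[≠] 0) (𝓝 (Φ 0)) :=
      hΦ.self_of_nhds.continuousAt.tendsto.comp tendsto_cuspPoint
    exact (h1.congr' (by filter_upwards [hw] with z hz using hz.2.symm)).isBigO_one ℝ
  · rintro (_ | n) hn
    · omega
    obtain ⟨Ψ, h1, h2⟩ := exists_iterate_wirtinger hF hΨ n
    convert h2.tendsto_cuspTerm h1 using 2
    · rw [pow_zero, mul_one]
    · rw [hc, Nat.add_sub_cancel]
      push_cast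
      ring
  · rintro (_ | m) (_ | n) hm hn
    any_goals omega
    obtain ⟨Ψ, h1, h2⟩ := exists_iterate_wirtingerBar_wirtinger hF hΨ m n
    convert h2.tendsto_cuspTerm h1 using 2
    rw [hc, show m + 1 + (n + 1) - 1 = m + n + 1 by omega, Nat.add_sub_cancel, Nat.add_sub_cancel]
    push_cast
    ring
  · rintro (_ | n) hn
    · omega
    obtain ⟨Ψ, h1, h2⟩ := exists_iterate_wirtinger hF hΨ n
    simpa only [add_zero] using h2.isTheta_cuspTerm (hc0 _ (mul_ne_zero (hsgn n) (hfac n))) h1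
  · rintro (_ | n) hn
    · omega
    obtain ⟨Ψ, h1, h2⟩ := exists_iterate_wirtingerBar hF hΨ n
    simpa only [zero_add] using h2.isTheta_cuspTerm (hc0 _ (mul_ne_zero (hsgn n) (hfac n))) h1
  · rintro (_ | m) (_ | n) hm hn
    any_goals omega
    obtain ⟨Ψ, h1, h2⟩ := exists_iterate_wirtingerBar_wirtinger hF hΨ m n
    rw [add_comm (m + 1)]
    exact h2.isTheta_cuspTerm
      (hc0 _ (mul_ne_zero (mul_ne_zero (hsgn _) (hfac n)) (hfac m))) h1

end
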